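/- **Setting.** Fix a first-order language for *built-in constraints*, i.e. atomic formulas $R(\bar t)$ over built-in predicate symbols, equations $s=t$, and $\mathit{true}$, $\mathit{false}$, and a disjoint set of predicate symbols for *user-defined constraints* (atoms $p(\bar t)$ over the same terms); there are countably many variables. Equality is interpreted as identity and structures are non-empty. Conjunctions and finite multisets of constraints are identified, and $\mathrm{fv}$ denotes the free variables. $\exists_{-F}\,\varphi$ is the existential closure of $\varphi$ leaving the variables in $F$ free. The constraint theory $\mathcal{CT}$ is any set of coherent formulas $\forall(\mathbb C\to\exists\bar Z.\,\mathbb D)$, with $\mathbb C,\mathbb D$ possibly empty conjunctions of built-in constraints. A *rule* is $\mathbb K\backslash\mathbb H\Leftrightarrow\mathbb G\mid\mathbb C,\mathbb B$ with $\mathbb K,\mathbb H$ (not both empty) and $\mathbb B$ multisets of user-defined constraints, $\mathbb G,\mathbb C$ conjunctions of built-in constraints; its local variables are $\mathrm{lv}(r)=\mathrm{fv}(\mathbb G,\mathbb C,\mathbb B)\setminus\mathrm{fv}(\mathbb K,\mathbb H)$. It is a *propagation rule* if $\mathbb H=\emptyset$. A *program* is a finite set of rules; a *CPR program* has propagation rules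 only. The logical reading of a rule is $$\forall\big((\mathbb K\wedge\mathbb G)\to(\mathbb H\leftrightarrow\exists_{-\mathrm{fv}(\mathbb K,\mathbb H)}(\mathbb G\wedge\mathbb C\wedge\mathbb B))\big),$$ and $\mathcal{CP}$ is $\mathcal{CT}$ together with the logical readings of the rules of $\mathcal P$. A *state* is a triple $\langle\mathbb C;\mathbb E;\bar X\rangle$ of a multiset of user-defined constraints, a conjunction of built-in constraints and a finite set of (global) variables. $\equiv_a$ is the least equivalence relation on states such that 1. $\langle\mathbb C;Y{=}t\wedge\mathbb D;\bar X\rangle\equiv_a\langle\mathbb C[Y\backslash t];Y{=}t\wedge\mathbb D;\bar X\rangle$; 2. $\langle\mathbb C;\mathit{false};\bar X\rangle\equiv_a\langle\mathbb D;\mathit{false};\bar X\rangle$; 3. $\langle\mathbb C;\mathbb D;\bar X\rangle\equiv_a\langle\mathbb C;\mathbb E;\bar X\rangle$ if $\mathcal{CT}\vDash\exists_{-\mathrm{fv}(\mathbb C,\bar X)}\mathbb D\leftrightarrow\exists_{-\mathrm{fv}(\mathbb C,\bar X)}\mathbb E$; 4. $\langle\mathbb C;\mathbb E;\bar X\rangle\equiv_a\langle\mathbb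 C;\mathbb E;\{Y\}\cup\bar X\rangle$ if $Y\notin\mathrm{fv}(\mathbb C,\mathbb E)$. For a program $\mathcal Q$, $\to_{\mathcal Q}$ is the least relation on states that contains $$\langle\mathbb K,\mathbb H,\mathbb D;\ \mathbb G\wedge\mathbb E;\ \bar X\rangle\to_{\mathcal Q}\langle\mathbb B,\mathbb K,\mathbb D;\ \mathbb C\wedge\mathbb G\wedge\mathbb E;\ \bar X\rangle$$ for every renaming $r=(\mathbb K\backslash\mathbb H\Leftrightarrow\mathbb G\mid\mathbb C,\mathbb B)$ of a rule of $\mathcal Q$ whose local variables are fresh, $\mathrm{lv}(r)\cap(\mathrm{fv}(\mathbb D,\mathbb E)\cup\bar X)=\emptyset$, and that satisfies: $\sigma_1\equiv_a\sigma_1'\to_{\mathcal Q}\sigma_2'\equiv_a\sigma_2$ implies $\sigma_1\to_{\mathcal Q}\sigma_2$. The *coinductive semantics* of $\mathcal Q$ is the greatest fixpoint, among sets of states, $$[\![\mathcal Q]\!]=\nu\mathcal X.\big(\{\sigma\mid\forall\sigma'\,(\sigma\to_{\mathcal Q}\sigma'\Rightarrow\sigma'\in\mathcal X)\}\cap\{\sigma\mid\sigma\not\equiv_a\langle\emptyset;\mathit{false};\emptyset\rangle\}\big).$$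 **Theorem (soundness and completeness of the coinductive semantics for CPR).** Let $\mathcal P$ be a CPR program and let $n$ be a natural number greater than the number of constraints in the head of every rule of $\mathcal P$. Let $n\cdot\mathbb B$ denote the multiset $\mathbb B$ with all multiplicities multiplied by $n$, and let $\mathcal P^n$ be obtained from $\mathcal P$ by replacing each rule $\mathbb K\Rightarrow\mathbb G\mid\mathbb C,\mathbb B$ with $\mathbb K\Rightarrow\mathbb G\mid\mathbb C,\,n\cdot\mathbb B$ (only the user-defined part of the body is multiplied). Then, for every multiset $\mathbb E$ of user-defined constraints, every conjunction $\mathbb C$ of built-in constraints and every finite set $\bar X$ of variables, $$\langle n\cdot\mathbb E;\mathbb C;\bar X\rangle\in[\![\mathcal P^n]\!]\quad\Longleftrightarrow\quad\mathbb E\wedge\mathbb C\text{ is satisfiable within }\mathcal{CP},$$ i.e. some model of $\mathcal{CP}$ satisfies $\exists(\mathbb E\wedge\mathbb C)$. -/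

import Mathlib

universe u

namespace CHR

/- Throughout, `L` is the first-order language (function symbols and built-in predicate symbols)
of the built-in constraints, `S k` is the type of user-defined predicate symbols of arity `k`,
and the variables are the natural numbers. -/

/-! ### Syntax -/

/-- Built-in constraints: atomic formulas over `L`, including `true`, `false` and equality. -/
inductive BuiltIn (L : FirstOrder.Language.{u, u}) : Type u
  | verum : BuiltIn L
  | falsum : BuiltIn L
  | eq (s t : L.Term ℕ) : BuiltIn L
  | rel {k : ℕ} (R : L.Relations k) (ts : Fin k → L.Term ℕ) : BuiltIn L

/-- User-defined (CHR) constraints: a user-defined predicate symbol applied to terms. -/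
structure UserConstraint (L : FirstOrder.Language.{u, u}) (S : ℕ → Type u) : Type u where
  arity : ℕ
  sym : S arity
  args : Fin arity → L.Term ℕ

namespace BuiltIn

variable {L : FirstOrder.Language.{u, u}}

/-- Variables of a built-in constraint. -/
def fv : BuiltIn L → Set ℕ
  | verum => ∅
  | falsum => ∅
  | eq s t => (s.varFinset : Set ℕ) ∪ t.varFinset
  | rel _ ts => ⋃ i, ((ts i).varFinset : Set ℕ)

/-- Renaming of the variables of a built-in constraint. -/
def rename (ρ : Equiv.Perm ℕ) : BuiltIn L → BuiltIn L
  | verum => verum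
  | falsum => falsum
  | eq s t => eq (s.relabel ρ) (t.relabel ρ)
  | rel R ts => rel R (fun i => (ts i).relabel ρ)

/-- Truth of a built-in constraint in an `L`-structure under a valuation. -/
def Holds {M : Type u} [L.Structure M] (v : ℕ → M) : BuiltIn L → Prop
  | verum => True
  | falsum => False
  | eq s t => s.realize v = t.realize v
  | rel R ts => FirstOrder.Language.Structure.RelMap R (fun i => (ts i).realize v)

end BuiltIn

namespace UserConstraint

variable {L : FirstOrder.Language.{u, u}} {S : ℕ → Type u}

/-- Variables of a user-defined constraint. -/
def fv (c : UserConstraint L S) : Set ℕ := ⋃ i, ((c.args i).varFinset : Set ℕ)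

/-- Renaming of the variables of a user-defined constraint. -/
def rename (ρ : Equiv.Perm ℕ) (c : UserConstraint L S) : UserConstraint L S :=
  ⟨c.arity, c.sym, fun i => (c.args i).relabel ρ⟩

/-- The substitution `c[Y \ t]` of the term `t` for the variable `Y`. -/
def subst (Y : ℕ) (t : L.Term ℕ) (c : UserConstraint L S) : UserConstraint L S :=
  ⟨c.arity, c.sym, fun i => (c.args i).subst (Function.update FirstOrder.Language.Term.var Y t)⟩

/-- Truth of a user-defined constraint, where `I` interprets the user-defined predicate
symbols as relations on the `L`-structure `M`. -/
def Holds {M : Type u} [L.Structure M] (I : ∀ k, S k → (Fin k → M) → Prop) (v : ℕ → M)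
    (c : UserConstraint L S) : Prop :=
  I c.arity c.sym (fun i => (c.args i).realize v)

end UserConstraint

/- Conjunctions and multisets of constraints are identified. -/

/-- Variables of a conjunction of built-in constraints. -/
def fvB {L : FirstOrder.Language.{u, u}} (D : Multiset (BuiltIn L)) : Set ℕ :=
  {x | ∃ d ∈ D, x ∈ d.fv}

/-- Variables of a multiset of user-defined constraints. -/
def fvU {L : FirstOrder.Language.{u, u}} {S : ℕ → Type u} (C : Multiset (UserConstraint L S)) : Set ℕ :=
  {x | ∃ c ∈ C, x ∈ c.fv}

/-- Truth of a conjunction of built-in constraints. -/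
def HoldsB {L : FirstOrder.Language.{u, u}} {M : Type u} [L.Structure M] (v : ℕ → M)
    (D : Multiset (BuiltIn L)) : Prop :=
  ∀ d ∈ D, d.Holds v

/-- Truth of a conjunction of user-defined constraints. -/
def HoldsU {L : FirstOrder.Language.{u, u}} {S : ℕ → Type u} {M : Type u} [L.Structure M]
    (I : ∀ k, S k → (Fin k → M) → Prop) (v : ℕ → M)
    (C : Multiset (UserConstraint L S)) : Prop :=
  ∀ c ∈ C, c.Holds I v

/-- Truth, under `v`, of the existential closure of `φ` that leaves the variables in `F` free. -/
def ExistsExcept {M : Type u} (F : Set ℕ) (φ : (ℕ → M) → Prop) (v : ℕ → M) : Prop :=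
  ∃ w : ℕ → M, (∀ x ∈ F, w x = v x) ∧ φ w

/-! ### Constraint theories -/

/-- A coherent formula `∀ (premise → ∃ exVars. conclusion)` over the built-in constraints. -/
structure CoherentFormula (L : FirstOrder.Language.{u, u}) : Type u where
  premise : Multiset (BuiltIn L)
  exVars : Finset ℕ
  conclusion : Multiset (BuiltIn L)

/-- Truth of a coherent formula in an `L`-structure. -/
def CoherentFormula.Holds {L : FirstOrder.Language.{u, u}} (a : CoherentFormula L) (M : Type u)
    [L.Structure M] : Prop :=
  ∀ v : ℕ → M, HoldsB v a.premise →
    ∃ w : ℕ → M, (∀ x, x ∉ a.exVars → w x = v x) ∧ HoldsB w a.conclusion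

/-- A constraint theory is a set of coherent formulas (its non-logical axioms). -/
abbrev ConstraintTheory (L : FirstOrder.Language.{u, u}) : Type u := Set (CoherentFormula L)

/-- `M` is a model of the constraint theory `CT`. -/
def ConstraintTheory.Models {L : FirstOrder.Language.{u, u}} (CT : ConstraintTheory L) (M : Type u)
    [L.Structure M] : Prop :=
  ∀ a ∈ CT, a.Holds M

/-! ### Rules and programs -/

/-- A CHR rule `kept \ removed ⟺ guard | bodyB, bodyU`, whose head is not empty. -/
structure Rule (L : FirstOrder.Language.{u, u}) (S : ℕ → Type u) : Type u where
  kept : Multiset (UserConstraint L S)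
  removed : Multiset (UserConstraint L S)
  guard : Multiset (BuiltIn L)
  bodyB : Multiset (BuiltIn L)
  bodyU : Multiset (UserConstraint L S)
  head_nonempty : kept + removed ≠ 0

namespace Rule

variable {L : FirstOrder.Language.{u, u}} {S : ℕ → Type u}

/-- Number of constraints in the head. -/
def headSize (r : Rule L S) : ℕ := Multiset.card (r.kept + r.removed)

/-- Propagation rules: nothing is removed. -/
def IsPropagation (r : Rule L S) : Prop := r.removed = 0

/-- Local variables: those of the guard and the body that do not occur in the head. -/
def lv (r : Rule L S) : Set ℕ :=
  (fvB r.guard ∪ fvB r.bodyB ∪ fvU r.bodyU) \ fvU (r.kept + r.removed)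

/-- Renaming of a rule. -/
def rename (ρ : Equiv.Perm ℕ) (r : Rule L S) : Rule L S where
  kept := r.kept.map (UserConstraint.rename ρ)
  removed := r.removed.map (UserConstraint.rename ρ)
  guard := r.guard.map (BuiltIn.rename ρ)
  bodyB := r.bodyB.map (BuiltIn.rename ρ)
  bodyU := r.bodyU.map (UserConstraint.rename ρ)
  head_nonempty := by
    rw [← Multiset.map_add, Ne, Multiset.map_eq_zero]
    exact r.head_nonempty

/-- Multiply the user-defined part of the body by `n`. -/
def scale (n : ℕ) (r : Rule L S) : Rule L S := { r with bodyU := n • r.bodyU }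

/-- Truth of the logical reading
`∀ ((kept ∧ guard) → (removed ↔ ∃_{-fv(kept, removed)} (guard ∧ bodyB ∧ bodyU)))` of a rule. -/
def Holds (r : Rule L S) (M : Type u) [L.Structure M]
    (I : ∀ k, S k → (Fin k → M) → Prop) : Prop :=
  ∀ v : ℕ → M, HoldsU I v r.kept ∧ HoldsB v r.guard →
    (HoldsU I v r.removed ↔
      ExistsExcept (fvU (r.kept + r.removed))
        (fun w => HoldsB w r.guard ∧ HoldsB w r.bodyB ∧ HoldsU I w r.bodyU) v)

end Rule

/-- A CHR program: a finite set of rules. -/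
structure Program (L : FirstOrder.Language.{u, u}) (S : ℕ → Type u) : Type u where
  rules : Set (Rule L S)
  finite : rules.Finite

namespace Program

variable {L : FirstOrder.Language.{u, u}} {S : ℕ → Type u}

/-- CPR programs: all rules are propagation rules. -/
def IsCPR (P : Program L S) : Prop := ∀ r ∈ P.rules, r.IsPropagation

/-- The program `P ^ n`, in which the user-defined part of each body is multiplied by `n`. -/
def scale (n : ℕ) (P : Program L S) : Program L S where
  rules := Rule.scale n '' P.rules
  finite := P.finite.image _

end Program

/-- `E ∧ C` is satisfiable within the logical reading of `P` in the theory `CT`: some (non-empty)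
model of `CT` and of the logical readings of all rules of `P` satisfies `∃ (E ∧ C)`. -/
def SatisfiableWithin {L : FirstOrder.Language.{u, u}} {S : ℕ → Type u} (CT : ConstraintTheory L)
    (P : Program L S) (E : Multiset (UserConstraint L S)) (C : Multiset (BuiltIn L)) : Prop :=
  ∃ (M : Type u) (_ : Nonempty M) (_ : L.Structure M) (I : ∀ k, S k → (Fin k → M) → Prop),
    CT.Models M ∧ (∀ r ∈ P.rules, r.Holds M I) ∧ ∃ v : ℕ → M, HoldsU I v E ∧ HoldsB v C

/-! ### States and their equivalence -/

/-- A CHR state: CHR store, built-in store, global variables. -/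
structure State (L : FirstOrder.Language.{u, u}) (S : ℕ → Type u) : Type u where
  user : Multiset (UserConstraint L S)
  builtin : Multiset (BuiltIn L)
  globals : Finset ℕ

/-- `CT ⊨ ∃_{-F} D ↔ ∃_{-F} E`, with the free variables universally closed. -/
def EntailsIff {L : FirstOrder.Language.{u, u}} (CT : ConstraintTheory L) (F : Set ℕ)
    (D E : Multiset (BuiltIn L)) : Prop :=
  ∀ (M : Type u) [Nonempty M] [L.Structure M], CT.Models M →
    ∀ v : ℕ → M,
      ExistsExcept F (fun w => HoldsB w D) v ↔ ExistsExcept F (fun w => HoldsB w E) v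

/-- The four generating clauses of the abstract equivalence. -/
inductive BaseEquiv {L : FirstOrder.Language.{u, u}} {S : ℕ → Type u} (CT : ConstraintTheory L) :
    State L S → State L S → Prop
  | subst (C : Multiset (UserConstraint L S)) (D : Multiset (BuiltIn L)) (X : Finset ℕ)
      (Y : ℕ) (t : L.Term ℕ) :
      BaseEquiv CT ⟨C, BuiltIn.eq (FirstOrder.Language.Term.var Y) t ::ₘ D, X⟩
        ⟨C.map (UserConstraint.subst Y t), BuiltIn.eq (FirstOrder.Language.Term.var Y) t ::ₘ D, X⟩
  | inconsistent (C D : Multiset (UserConstraint L S)) (X : Finset ℕ) :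
      BaseEquiv CT ⟨C, {BuiltIn.falsum}, X⟩ ⟨D, {BuiltIn.falsum}, X⟩
  | transform (C : Multiset (UserConstraint L S)) (D E : Multiset (BuiltIn L)) (X : Finset ℕ)
      (h : EntailsIff CT (fvU C ∪ X) D E) :
      BaseEquiv CT ⟨C, D, X⟩ ⟨C, E, X⟩
  | omission (C : Multiset (UserConstraint L S)) (E : Multiset (BuiltIn L)) (X : Finset ℕ)
      (Y : ℕ) (h : Y ∉ fvU C ∪ fvB E) :
      BaseEquiv CT ⟨C, E, X⟩ ⟨C, E, insert Y X⟩

/-- The abstract equivalence: the least equivalence relation satisfying the four clauses. -/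
def AEquiv {L : FirstOrder.Language.{u, u}} {S : ℕ → Type u} (CT : ConstraintTheory L) :
    State L S → State L S → Prop :=
  Relation.EqvGen (BaseEquiv CT)

/-- The failure state `⟨∅; false; ∅⟩`. -/
def failure (L : FirstOrder.Language.{u, u}) (S : ℕ → Type u) : State L S := ⟨0, {BuiltIn.falsum}, ∅⟩

/-! ### Operational and coinductive semantics -/

/-- The transition relation of `P` modulo an equivalence `equiv` on states. The rule is renamed
so that its local variables are fresh for the rest of the state. -/
inductive Step {L : FirstOrder.Language.{u, u}} {S : ℕ → Type u} (equiv : State L S → State L S → Prop)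
    (P : Program L S) : State L S → State L S → Prop
  | apply (r₀ : Rule L S) (hr₀ : r₀ ∈ P.rules) (ρ : Equiv.Perm ℕ) (r : Rule L S)
      (hr : r = r₀.rename ρ) (D : Multiset (UserConstraint L S)) (E : Multiset (BuiltIn L))
      (X : Finset ℕ) (fresh : Disjoint r.lv (fvU D ∪ fvB E ∪ X)) :
      Step equiv P ⟨r.kept + r.removed + D, r.guard + E, X⟩
        ⟨r.bodyU + r.kept + D, r.bodyB + r.guard + E, X⟩
  | congr {σ₁ σ₁' σ₂' σ₂ : State L S} (h₁ : equiv σ₁ σ₁') (h : Step equiv P σ₁' σ₂')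
      (h₂ : equiv σ₂' σ₂) : Step equiv P σ₁ σ₂

/-- The universal immediate cause operator: states all of whose successors are in `𝒳`. -/
def universalCause {L : FirstOrder.Language.{u, u}} {S : ℕ → Type u}
    (equiv : State L S → State L S → Prop) (P : Program L S) (𝒳 : Set (State L S)) :
    Set (State L S) :=
  {σ | ∀ σ', Step equiv P σ σ' → σ' ∈ 𝒳}

/-- The monotone operator `𝒳 ↦ [P] 𝒳 ∩ (Σ ∖ ⟦failure⟧)` over the abstract transition system. -/
def coinductiveOperator {L : FirstOrder.Language.{u, u}} {S : ℕ → Type u} (CT : ConstraintTheory L)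
    (P : Program L S) : Set (State L S) →o Set (State L S) where
  toFun 𝒳 := universalCause (AEquiv CT) P 𝒳 ∩ {σ | AEquiv CT (failure L S) σ}ᶜ
  monotone' := fun _ _ h _ hσ => ⟨fun σ' hs => h (hσ.1 σ' hs), hσ.2⟩

/-- The coinductive transition system semantics: the greatest fixpoint of the operator above. -/
def coinductiveSemantics {L : FirstOrder.Language.{u, u}} {S : ℕ → Type u} (CT : ConstraintTheory L)
    (P : Program L S) : Set (State L S) :=
  (coinductiveOperator CT P).gfp

end CHR

/-!
Soundness holds because satisfiability of a state within `CT` and the logical reading of `P` is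
invariant under the four clauses of the abstract equivalence and preserved by rule applications
(`Step.satisfiable`; the multiplicities in `P ^ n` are irrelevant to truth). The satisfiable states
thus form a post-fixed point that avoids failure.

For completeness, a model is built from the transitions available inside the coinductive semantics.
A *condition* is a pair of stores `(U, C)` such that `⟨n • U; C; X⟩` lies in the semantics; its
built-in store is consistent with `CT`. Conditions can be enlarged in two ways. If the premise of a
valid coherent formula is entailed, then its conclusion with fresh names for the witnesses may be
added, up to equivalence (`Condition.exists_ge_of_coherent`). If the head of a rule is matched up to
entailed equality and its guard is entailed, then the rule fires
(`Condition.exists_ge_of_rule`); this is where `n` copies of each constraint are needed, since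
several constraints of the head may match the same stored one, and where user-defined constraints
are exchanged for entailed-equal ones (`aequiv_replace`).

By the Rasiowa–Sikorski lemma some ideal of conditions is closed under all these enlargements, for
countably many formulas (`exists_saturated_ideal`). The *generic model* has the variables modulo
entailed equality as elements, and in it exactly the entailed atoms are true. Since the ideal
chooses witnesses for the existential quantifiers among the variables, every element has a name, and
rules hold at all elements, not only at those mentioned in the initial state. Function symbols are
handled by counting the sentences `∀ x. ∃ y. y = f(x)` among the formulas, for the countably many `f`
that matter; the other function symbols are interpreted arbitrarily.

As `CT` and the language may be uncountable, this gives models of the countable subtheories of `CT`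
only (`satisfiableWithin_of_countable`). Coherent formulas and propagation rules are preserved by
ultraproducts, and an ultraproduct over the finite subsets of `CT` is a model of all of `CT`
(`satisfiableWithin_of_finite`).
-/

namespace CHR

open FirstOrder FirstOrder.Language

variable {L : FirstOrder.Language.{u, u}} {S : ℕ → Type u}

/-! ### Truth depends only on the free variables -/

section Basic

variable {M : Type u} [L.Structure M]

theorem realize_congr {v w : ℕ → M} (t : L.Term ℕ) (h : ∀ x ∈ t.varFinset, v x = w x) :
    t.realize v = t.realize w := by
  induction t with
  | var x => exact h x (by simp [Term.varFinset])
  | func f ts ih =>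
    simp only [Term.realize]
    congr 1
    funext i
    exact ih i fun x hx => h x (by simpa [Term.varFinset] using ⟨i, hx⟩)

theorem BuiltIn.holds_congr {v w : ℕ → M} (d : BuiltIn L) (h : ∀ x ∈ d.fv, v x = w x) :
    d.Holds v ↔ d.Holds w := by
  cases d with
  | verum => rfl
  | falsum => rfl
  | eq s t =>
    simp only [BuiltIn.fv, Set.mem_union, Finset.mem_coe] at h
    simp only [BuiltIn.Holds]
    rw [realize_congr s fun x hx => h x (.inl hx), realize_congr t fun x hx => h x (.inr hx)]
  | rel R ts =>
    simp only [BuiltIn.fv, Set.mem_iUnion, Finset.mem_coe] at h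
    simp only [BuiltIn.Holds]
    rw [funext fun i => realize_congr (ts i) fun x hx => h x ⟨i, hx⟩]

/-- The ground atom named by a user-defined constraint under a valuation. -/
def UserConstraint.eval (v : ℕ → M) (c : UserConstraint L S) : Σ k, S k × (Fin k → M) :=
  ⟨c.arity, c.sym, fun i => (c.args i).realize v⟩

theorem UserConstraint.eval_congr {v w : ℕ → M} (c : UserConstraint L S)
    (h : ∀ x ∈ c.fv, v x = w x) : c.eval v = c.eval w := by
  simp only [UserConstraint.fv, Set.mem_iUnion, Finset.mem_coe] at h
  simp only [UserConstraint.eval]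
  rw [funext fun i => realize_congr (c.args i) fun x hx => h x ⟨i, hx⟩]

theorem UserConstraint.holds_iff_of_eval_eq {I : ∀ k, S k → (Fin k → M) → Prop} {v w : ℕ → M}
    {c c' : UserConstraint L S} (h : c.eval v = c'.eval w) : c.Holds I v ↔ c'.Holds I w :=
  iff_of_eq (congrArg (fun a : Σ k, S k × (Fin k → M) => I a.1 a.2.1 a.2.2) h)

theorem holdsB_congr {v w : ℕ → M} {D : Multiset (BuiltIn L)} (h : ∀ x ∈ fvB D, v x = w x) :
    HoldsB v D ↔ HoldsB w D :=
  forall₂_congr fun d hd => d.holds_congr fun x hx => h x ⟨d, hd, hx⟩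

theorem holdsU_congr {I : ∀ k, S k → (Fin k → M) → Prop} {v w : ℕ → M}
    {C : Multiset (UserConstraint L S)} (h : ∀ x ∈ fvU C, v x = w x) :
    HoldsU I v C ↔ HoldsU I w C :=
  forall₂_congr fun c hc =>
    UserConstraint.holds_iff_of_eval_eq (c.eval_congr fun x hx => h x ⟨c, hc, hx⟩)

@[simp] theorem holdsB_zero {v : ℕ → M} : HoldsB (L := L) v 0 := by simp [HoldsB]

@[simp] theorem holdsB_add {v : ℕ → M} {D E : Multiset (BuiltIn L)} :
    HoldsB v (D + E) ↔ HoldsB v D ∧ HoldsB v E := by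
  simp only [HoldsB, Multiset.mem_add, or_imp, forall_and]

@[simp] theorem holdsB_cons {v : ℕ → M} {d : BuiltIn L} {D : Multiset (BuiltIn L)} :
    HoldsB v (d ::ₘ D) ↔ d.Holds v ∧ HoldsB v D := by
  simp [HoldsB]

@[simp] theorem holdsU_add {I : ∀ k, S k → (Fin k → M) → Prop} {v : ℕ → M}
    {C D : Multiset (UserConstraint L S)} :
    HoldsU I v (C + D) ↔ HoldsU I v C ∧ HoldsU I v D := by
  simp only [HoldsU, Multiset.mem_add, or_imp, forall_and]

theorem HoldsU.nsmul {I : ∀ k, S k → (Fin k → M) → Prop} {v : ℕ → M}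
    {C : Multiset (UserConstraint L S)} (h : HoldsU I v C) (n : ℕ) : HoldsU I v (n • C) :=
  fun c hc => h c (Multiset.mem_of_mem_nsmul hc)

theorem not_holdsB_falsum {v : ℕ → M} : ¬ HoldsB (L := L) v {BuiltIn.falsum} :=
  fun h => h _ (Multiset.mem_singleton_self _)

theorem BuiltIn.holds_rename (ρ : Equiv.Perm ℕ) {v : ℕ → M} (d : BuiltIn L) :
    (d.rename ρ).Holds v ↔ d.Holds (v ∘ ρ) := by
  cases d <;> simp [BuiltIn.rename, BuiltIn.Holds, Term.realize_relabel]

theorem UserConstraint.eval_rename (ρ : Equiv.Perm ℕ) {v : ℕ → M} (c : UserConstraint L S) :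
    (c.rename ρ).eval v = c.eval (v ∘ ρ) := by
  simp [UserConstraint.rename, UserConstraint.eval, Term.realize_relabel]

theorem UserConstraint.holds_rename {I : ∀ k, S k → (Fin k → M) → Prop} (ρ : Equiv.Perm ℕ)
    {v : ℕ → M} (c : UserConstraint L S) : (c.rename ρ).Holds I v ↔ c.Holds I (v ∘ ρ) :=
  UserConstraint.holds_iff_of_eval_eq (c.eval_rename ρ)

theorem UserConstraint.holds_subst {I : ∀ k, S k → (Fin k → M) → Prop} {v : ℕ → M} {Y : ℕ}
    {t : L.Term ℕ} (h : v Y = t.realize v) (c : UserConstraint L S) :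
    (c.subst Y t).Holds I v ↔ c.Holds I v := by
  refine UserConstraint.holds_iff_of_eval_eq ?_
  have hv : (fun a => (Function.update Term.var Y t a : L.Term ℕ).realize v) = v := by
    funext a
    by_cases ha : a = Y
    · subst ha; simp [h]
    · simp [ha]
  simp [UserConstraint.subst, UserConstraint.eval, Term.realize_subst, hv]

theorem holdsB_rename (ρ : Equiv.Perm ℕ) {v : ℕ → M} {D : Multiset (BuiltIn L)} :
    HoldsB v (D.map (BuiltIn.rename ρ)) ↔ HoldsB (v ∘ ρ) D := by
  simp [HoldsB, BuiltIn.holds_rename]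

theorem holdsU_rename {I : ∀ k, S k → (Fin k → M) → Prop} (ρ : Equiv.Perm ℕ) {v : ℕ → M}
    {C : Multiset (UserConstraint L S)} :
    HoldsU I v (C.map (UserConstraint.rename ρ)) ↔ HoldsU I (v ∘ ρ) C := by
  simp [HoldsU, UserConstraint.holds_rename]

end Basic

/-! ### Free variables -/

section FreeVariables

theorem BuiltIn.finite_fv (d : BuiltIn L) : d.fv.Finite := by
  cases d with
  | verum => exact Set.finite_empty
  | falsum => exact Set.finite_empty
  | eq s t => exact (Finset.finite_toSet _).union (Finset.finite_toSet _)
  | rel R ts => exact Set.finite_iUnion fun i => Finset.finite_toSet _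

theorem UserConstraint.finite_fv (c : UserConstraint L S) : c.fv.Finite :=
  Set.finite_iUnion fun _ => Finset.finite_toSet _

theorem finite_fvB (D : Multiset (BuiltIn L)) : (fvB D).Finite := by
  classical
  have h : fvB D = ⋃ d ∈ (D.toFinset : Set (BuiltIn L)), d.fv := by ext; simp [fvB]
  rw [h]
  exact (Finset.finite_toSet _).biUnion fun d _ => d.finite_fv

theorem finite_fvU (C : Multiset (UserConstraint L S)) : (fvU C).Finite := by
  classical
  have h : fvU C = ⋃ c ∈ (C.toFinset : Set (UserConstraint L S)), c.fv := by ext; simp [fvU]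
  rw [h]
  exact (Finset.finite_toSet _).biUnion fun d _ => d.finite_fv

theorem varFinset_relabel (ρ : ℕ → ℕ) (t : L.Term ℕ) :
    (t.relabel ρ).varFinset = t.varFinset.image ρ := by
  induction t with
  | var x => simp [Term.relabel, Term.varFinset]
  | func f ts ih => ext x; simp [Term.relabel, Term.varFinset, ih]; grind

theorem BuiltIn.fv_rename (ρ : Equiv.Perm ℕ) (d : BuiltIn L) : (d.rename ρ).fv = ρ '' d.fv := by
  cases d <;> simp [BuiltIn.rename, BuiltIn.fv, varFinset_relabel, Set.image_union,
    Set.image_iUnion]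

theorem UserConstraint.fv_rename (ρ : Equiv.Perm ℕ) (c : UserConstraint L S) :
    (c.rename ρ).fv = ρ '' c.fv := by
  simp [UserConstraint.rename, UserConstraint.fv, varFinset_relabel, Set.image_iUnion]

theorem fvB_rename (ρ : Equiv.Perm ℕ) (D : Multiset (BuiltIn L)) :
    fvB (D.map (BuiltIn.rename ρ)) = ρ '' fvB D := by
  ext x
  simp only [fvB, Multiset.mem_map, Set.mem_ofPred_eq, exists_exists_and_eq_and, BuiltIn.fv_rename,
    Set.mem_image]
  grind

theorem fvU_rename (ρ : Equiv.Perm ℕ) (C : Multiset (UserConstraint L S)) :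
    fvU (C.map (UserConstraint.rename ρ)) = ρ '' fvU C := by
  ext x
  simp only [fvU, Multiset.mem_map, Set.mem_ofPred_eq, exists_exists_and_eq_and,
    UserConstraint.fv_rename, Set.mem_image]
  grind

theorem fvU_mono {C D : Multiset (UserConstraint L S)} (h : C ⊆ D) : fvU C ⊆ fvU D :=
  fun _ ⟨c, hc, hx⟩ => ⟨c, h hc, hx⟩

theorem fvU_add (C D : Multiset (UserConstraint L S)) : fvU (C + D) = fvU C ∪ fvU D := by
  ext x; simp [fvU, or_and_right, exists_or]

theorem fvU_cons (c : UserConstraint L S) (D : Multiset (UserConstraint L S)) :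
    fvU (c ::ₘ D) = c.fv ∪ fvU D := by
  ext x; simp [fvU]

theorem fvB_add (C D : Multiset (BuiltIn L)) : fvB (C + D) = fvB C ∪ fvB D := by
  ext x; simp [fvB, or_and_right, exists_or]

theorem fvU_nsmul_subset (n : ℕ) (C : Multiset (UserConstraint L S)) : fvU (n • C) ⊆ fvU C :=
  fvU_mono fun _ hc => Multiset.mem_of_mem_nsmul hc

end FreeVariables

/-! ### Soundness -/

/-- Satisfiability of a state within the logical reading of `P`. -/
def State.Satisfiable (CT : ConstraintTheory L) (P : Program L S) (σ : State L S) : Prop :=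
  SatisfiableWithin CT P σ.user σ.builtin

theorem satisfiable_iff_of_baseEquiv {CT : ConstraintTheory L} {P : Program L S}
    {σ τ : State L S} (h : BaseEquiv CT σ τ) : σ.Satisfiable CT P ↔ τ.Satisfiable CT P := by
  unfold State.Satisfiable SatisfiableWithin
  refine exists_congr fun M => exists_congr fun hne => exists_congr fun hstr =>
    exists_congr fun I => and_congr_right fun hCT => and_congr_right fun _ => ?_
  cases h with
  | subst C D X Y t =>
    refine exists_congr fun v => and_congr_left fun hv => ?_
    have hY : v Y = t.realize v := (holdsB_cons.1 hv).1
    simp [HoldsU, UserConstraint.holds_subst hY]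
  | inconsistent C D X => simp [not_holdsB_falsum]
  | transform C D E X h =>
    have key : ∀ {D E : Multiset (BuiltIn L)}, (∀ v : ℕ → M,
        ExistsExcept (fvU C ∪ X) (fun w => HoldsB w D) v →
        ExistsExcept (fvU C ∪ X) (fun w => HoldsB w E) v) →
        (∃ v : ℕ → M, HoldsU I v C ∧ HoldsB v D) → ∃ v : ℕ → M, HoldsU I v C ∧ HoldsB v E := by
      rintro D E h ⟨v, hC, hD⟩
      obtain ⟨w, hw, hE⟩ := h v ⟨v, fun _ _ => rfl, hD⟩
      exact ⟨w, (holdsU_congr fun x hx => hw x (.inl hx)).2 hC, hE⟩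
    exact ⟨key fun v => (h M hCT v).1, key fun v => (h M hCT v).2⟩
  | omission C E X Y h => rfl

theorem satisfiable_iff_of_aequiv {CT : ConstraintTheory L} {P : Program L S}
    {σ τ : State L S} (h : AEquiv CT σ τ) : σ.Satisfiable CT P ↔ τ.Satisfiable CT P := by
  induction h with
  | rel _ _ h => exact satisfiable_iff_of_baseEquiv h
  | refl => rfl
  | symm _ _ _ ih => exact ih.symm
  | trans _ _ _ _ _ ih₁ ih₂ => exact ih₁.trans ih₂

theorem Rule.Holds.rename {M : Type u} [L.Structure M] {I : ∀ k, S k → (Fin k → M) → Prop}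
    {r : Rule L S} (h : r.Holds M I) (ρ : Equiv.Perm ℕ) : (r.rename ρ).Holds M I := by
  intro v
  have h' := h (v ∘ ρ)
  simp only [Rule.rename, holdsU_rename, holdsB_rename, ← Multiset.map_add, fvU_rename]
  intro hv
  rw [h' hv]
  constructor
  · rintro ⟨w, hw, hφ⟩
    refine ⟨w ∘ ρ.symm, ?_, ?_⟩
    · rintro _ ⟨x, hx, rfl⟩
      simpa using hw x hx
    · simpa [Function.comp_assoc] using hφ
  · rintro ⟨w, hw, hφ⟩
    exact ⟨w ∘ ρ, fun x hx => hw _ ⟨x, hx, rfl⟩, hφ⟩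

theorem Rule.Holds.scale {M : Type u} [L.Structure M] {I : ∀ k, S k → (Fin k → M) → Prop}
    {r : Rule L S} (h : r.Holds M I) (hr : r.IsPropagation) (n : ℕ) :
    (r.scale n).Holds M I := by
  intro v hv
  have hrem : HoldsU I v r.removed := by
    rw [hr]; intro c hc; simp at hc
  obtain ⟨w, hw, hG, hC, hB⟩ := (h v hv).1 hrem
  exact iff_of_true hrem ⟨w, hw, hG, hC, hB.nsmul n⟩

/-- A rule application preserves satisfiability: the witnesses given by the logical reading of the
rule only affect its local variables, which are fresh. -/
theorem Step.satisfiable {CT : ConstraintTheory L} {P Q : Program L S}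
    (hQ : ∀ (M : Type u) [L.Structure M] (I : ∀ k, S k → (Fin k → M) → Prop),
      (∀ r ∈ P.rules, r.Holds M I) → ∀ r ∈ Q.rules, r.Holds M I)
    {σ τ : State L S} (h : Step (AEquiv CT) Q σ τ) (hσ : σ.Satisfiable CT P) :
    τ.Satisfiable CT P := by
  classical
  induction h with
  | congr h₁ _ h₂ ih =>
    exact (satisfiable_iff_of_aequiv h₂).1 (ih ((satisfiable_iff_of_aequiv h₁).1 hσ))
  | apply r₀ hr₀ ρ r hr D E X fresh =>
    obtain ⟨M, hne, hstr, I, hCT, hP, v, hU, hB⟩ := hσ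
    have hrule : r.Holds M I := hr ▸ (hQ M I hP r₀ hr₀).rename ρ
    simp only [holdsU_add, holdsB_add] at hU hB
    obtain ⟨w, hw, hwG, hwC, hwB⟩ := (hrule v ⟨hU.1.1, hB.1⟩).1 hU.1.2
    let v' : ℕ → M := fun x => if x ∈ r.lv then w x else v x
    have hfresh : ∀ x ∈ fvU D ∪ fvB E ∪ X, v' x = v x := fun x hx =>
      if_neg fun hl => Set.disjoint_left.1 fresh hl hx
    have hhead : ∀ x ∈ fvU (r.kept + r.removed), v' x = v x := fun x hx =>
      if_neg fun hl => hl.2 hx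
    have hbody : ∀ x ∈ fvB r.guard ∪ fvB r.bodyB ∪ fvU r.bodyU, v' x = w x := fun x hx => by
      by_cases hh : x ∈ fvU (r.kept + r.removed)
      · rw [hhead x hh, hw x hh]
      · exact if_pos ⟨hx, hh⟩
    refine ⟨M, hne, hstr, I, hCT, hP, v', ?_, ?_⟩
    · simp only [holdsU_add]
      refine ⟨⟨(holdsU_congr fun x hx => hbody x (.inr hx)).2 hwB,
        (holdsU_congr fun x hx => hhead x ?_).2 hU.1.1⟩,
        (holdsU_congr fun x hx => hfresh x (.inl (.inl hx))).2 hU.2⟩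
      exact fvU_mono (Multiset.subset_of_le (Multiset.le_add_right _ _)) hx
    · simp only [holdsB_add]
      exact ⟨⟨(holdsB_congr fun x hx => hbody x (.inl (.inr hx))).2 hwC,
        (holdsB_congr fun x hx => hbody x (.inl (.inl hx))).2 hwG⟩,
        (holdsB_congr fun x hx => hfresh x (.inl (.inr hx))).2 hB.2⟩

theorem mem_coinductiveSemantics_of_satisfiable {CT : ConstraintTheory L} {P : Program L S}
    (hP : P.IsCPR) (n : ℕ) {σ : State L S} (hσ : σ.Satisfiable CT P) :
    σ ∈ coinductiveSemantics CT (P.scale n) := by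
  refine OrderHom.le_gfp (coinductiveOperator CT (P.scale n)) (a := {σ | σ.Satisfiable CT P}) ?_ hσ
  refine fun σ hσ => ⟨fun τ hτ => hτ.satisfiable (P := P) ?_ hσ, fun hfail => ?_⟩
  · rintro M _ I hI _ ⟨r, hr, rfl⟩
    exact (hI r hr).scale (hP r hr) n
  · obtain ⟨M, _, _, I, _, _, v, _, hv⟩ := (satisfiable_iff_of_aequiv hfail).2 hσ
    exact not_holdsB_falsum hv

/-! ### Derived equivalences of states -/

/-- A model of the constraint theory together with a valuation of the variables in it. Semantic
entailment of a property by a built-in store `C` is expressed by saying that every point at which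
`C` holds has that property. -/
structure Point (CT : ConstraintTheory L) : Type (u + 1) where
  carrier : Type u
  [nonempty : Nonempty carrier]
  [str : L.Structure carrier]
  models : CT.Models carrier
  val : ℕ → carrier

attribute [instance] Point.nonempty Point.str

section Equivalences

variable {CT : ConstraintTheory L}

theorem AEquiv.symm {σ τ : State L S} (h : AEquiv CT σ τ) : AEquiv CT τ σ :=
  Relation.EqvGen.symm _ _ h

theorem AEquiv.trans {σ τ υ : State L S} (h : AEquiv CT σ τ) (h' : AEquiv CT τ υ) :
    AEquiv CT σ υ := Relation.EqvGen.trans _ _ _ h h'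

theorem AEquiv.rfl {σ : State L S} : AEquiv CT σ σ := .refl _

theorem aequiv_transform {U : Multiset (UserConstraint L S)} {D E : Multiset (BuiltIn L)}
    {X : Finset ℕ}
    (hDE : ∀ p : Point CT, HoldsB p.val D →
      ∃ w : ℕ → p.carrier, (∀ x ∈ fvU U ∪ X, w x = p.val x) ∧ HoldsB w E)
    (hED : ∀ p : Point CT, HoldsB p.val E →
      ∃ w : ℕ → p.carrier, (∀ x ∈ fvU U ∪ X, w x = p.val x) ∧ HoldsB w D) :
    AEquiv CT (⟨U, D, X⟩ : State L S) ⟨U, E, X⟩ := by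
  refine .rel _ _ (.transform U D E X fun M _ _ hM v => ⟨?_, ?_⟩)
  · rintro ⟨w, hw, h⟩
    obtain ⟨w', hw', h'⟩ := hDE ⟨M, hM, w⟩ h
    exact ⟨w', fun x hx => (hw' x hx).trans (hw x hx), h'⟩
  · rintro ⟨w, hw, h⟩
    obtain ⟨w', hw', h'⟩ := hED ⟨M, hM, w⟩ h
    exact ⟨w', fun x hx => (hw' x hx).trans (hw x hx), h'⟩

theorem aequiv_of_entails {U : Multiset (UserConstraint L S)} {D E : Multiset (BuiltIn L)}
    {X : Finset ℕ} (h : ∀ p : Point CT, HoldsB p.val D ↔ HoldsB p.val E) :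
    AEquiv CT (⟨U, D, X⟩ : State L S) ⟨U, E, X⟩ :=
  aequiv_transform (fun p hp => ⟨p.val, fun _ _ => rfl, (h p).1 hp⟩)
    (fun p hp => ⟨p.val, fun _ _ => rfl, (h p).2 hp⟩)

theorem aequiv_of_inconsistent {U V : Multiset (UserConstraint L S)} {D : Multiset (BuiltIn L)}
    {X : Finset ℕ} (h : ∀ p : Point CT, ¬ HoldsB p.val D) :
    AEquiv CT (⟨U, D, X⟩ : State L S) ⟨V, D, X⟩ := by
  have h' : ∀ p : Point CT, HoldsB p.val D ↔ HoldsB (L := L) p.val {BuiltIn.falsum} := fun p =>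
    iff_of_false (h p) not_holdsB_falsum
  exact (aequiv_of_entails h').trans
    ((Relation.EqvGen.rel _ _ (.inconsistent U V X)).trans _ _ _ (aequiv_of_entails h').symm)

theorem failure_aequiv_of_inconsistent {U : Multiset (UserConstraint L S)}
    {D : Multiset (BuiltIn L)} {X : Finset ℕ} (h : ∀ p : Point CT, ¬ HoldsB p.val D) :
    AEquiv CT (failure L S) ⟨U, D, X⟩ := by
  classical
  have hX : AEquiv CT (failure L S) ⟨0, {BuiltIn.falsum}, X⟩ := by
    induction X using Finset.induction_on with
    | empty => exact .rfl
    | insert Y X _ ih =>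
      exact ih.trans (.rel _ _ (.omission _ _ _ _ (by simp [fvU, fvB, BuiltIn.fv])))
  have h' : ∀ p : Point CT, HoldsB (L := L) p.val {BuiltIn.falsum} ↔ HoldsB p.val D := fun p =>
    iff_of_false not_holdsB_falsum (h p)
  exact (hX.trans (aequiv_of_entails h')).trans (aequiv_of_inconsistent h)

theorem UserConstraint.subst_of_notMem {Y : ℕ} {t : L.Term ℕ} {c : UserConstraint L S}
    (hY : Y ∉ c.fv) : c.subst Y t = c := by
  have key : ∀ s : L.Term ℕ, Y ∉ s.varFinset →
      s.subst (Function.update Term.var Y t) = s := by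
    intro s hs
    induction s with
    | var x =>
      have hx : x ≠ Y := by rintro rfl; simp [Term.varFinset] at hs
      simp [Term.subst, hx]
    | func f ts ih =>
      simp only [Term.subst]
      congr 1
      funext i
      refine ih i fun h => hs ?_
      simpa [Term.varFinset] using ⟨i, h⟩
  simp only [UserConstraint.fv, Set.mem_iUnion, Finset.mem_coe, not_exists] at hY
  obtain ⟨k, p, ts⟩ := c
  simp only [UserConstraint.subst]
  congr 1
  exact funext fun i => key _ (hY i)

/-- Replacing one argument of a user-defined constraint by a term that the store entails to be
equal to it. As the clauses of the equivalence only substitute for variables, a fresh variable `z`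
equated with both terms is introduced and dropped again. -/
theorem aequiv_update_arg {U : Multiset (UserConstraint L S)} {D : Multiset (BuiltIn L)}
    {X : Finset ℕ} {k : ℕ} (p : S k) (ts : Fin k → L.Term ℕ) (i : Fin k) (t : L.Term ℕ)
    (h : ∀ q : Point CT, HoldsB q.val D → (ts i).realize q.val = t.realize q.val) :
    AEquiv CT (⟨⟨k, p, ts⟩ ::ₘ U, D, X⟩ : State L S)
      ⟨⟨k, p, Function.update ts i t⟩ ::ₘ U, D, X⟩ := by
  classical
  obtain ⟨z, hz⟩ := ((((((finite_fvU ((⟨k, p, ts⟩ : UserConstraint L S) ::ₘ U)).union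
    (finite_fvU ((⟨k, p, Function.update ts i t⟩ : UserConstraint L S) ::ₘ U))).union
    (finite_fvB D)).union X.finite_toSet).union
    (Finset.finite_toSet (ts i).varFinset)).union
    (Finset.finite_toSet t.varFinset)).exists_notMem
  simp only [Set.mem_union, not_or, Finset.mem_coe, fvU_cons] at hz
  obtain ⟨⟨⟨⟨⟨⟨hz₁, hzU⟩, ⟨hz₂, -⟩⟩, hzD⟩, hzX⟩, hzs⟩, hzt⟩ := hz
  -- Defining the fresh variable `z` by a term `s` is harmless.
  have define : ∀ (c : UserConstraint L S) (s : L.Term ℕ), z ∉ c.fv → z ∉ s.varFinset →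
      AEquiv CT (⟨c ::ₘ U, D, X⟩ : State L S)
        ⟨c ::ₘ U, BuiltIn.eq (Term.var z) s ::ₘ D, X⟩ := by
    intro c s hc hs
    refine aequiv_transform (fun q hq => ⟨Function.update q.val z (s.realize q.val), ?_, ?_⟩)
      fun q hq => ⟨q.val, fun _ _ => rfl, (holdsB_cons.1 hq).2⟩
    · intro x hx
      refine Function.update_of_ne ?_ _ _
      rintro rfl
      simp [fvU_cons, hc, hzU, hzX] at hx
    · refine holdsB_cons.2 ⟨?_, (holdsB_congr (w := q.val) fun x hx => ?_).2 hq⟩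
      · simp only [BuiltIn.Holds, Term.realize_var, Function.update_self]
        refine realize_congr s fun x hx => (Function.update_of_ne ?_ _ _).symm
        rintro rfl
        exact hs hx
      · refine Function.update_of_ne ?_ _ _
        rintro rfl
        exact hzD hx
  -- A constraint with `z` in place of the argument is a common ancestor of both sides.
  have subst : ∀ s : L.Term ℕ,
      AEquiv CT
        (⟨⟨k, p, Function.update ts i (Term.var z)⟩ ::ₘ U, BuiltIn.eq (Term.var z) s ::ₘ D, X⟩ :
          State L S)
        ⟨⟨k, p, Function.update ts i s⟩ ::ₘ U, BuiltIn.eq (Term.var z) s ::ₘ D, X⟩ := by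
    intro s
    have h := Relation.EqvGen.rel _ _ (BaseEquiv.subst (CT := CT)
      (⟨k, p, Function.update ts i (Term.var z)⟩ ::ₘ U) D X z s)
    have hU : U.map (UserConstraint.subst z s) = U := by
      conv_rhs => rw [← Multiset.map_id' U]
      exact Multiset.map_congr rfl fun c hc =>
        UserConstraint.subst_of_notMem fun hx => hzU ⟨c, hc, hx⟩
    have hc : UserConstraint.subst z s ⟨k, p, Function.update ts i (Term.var z)⟩ =
        (⟨k, p, Function.update ts i s⟩ : UserConstraint L S) := by
      simp only [UserConstraint.subst]
      congr 1
      funext j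
      by_cases hj : j = i
      · subst hj; simp [Term.subst]
      · have hc := UserConstraint.subst_of_notMem (t := s) hz₁
        simp only [UserConstraint.subst, UserConstraint.mk.injEq, heq_eq_eq, true_and] at hc
        simpa [hj] using congrFun hc j
    rwa [Multiset.map_cons, hU, hc] at h
  have hts : Function.update ts i (ts i) = ts := Function.update_eq_self i ts
  refine (define _ (ts i) hz₁ hzs).trans ?_
  have h₁ := subst (ts i)
  rw [hts] at h₁
  refine h₁.symm.trans (AEquiv.trans (aequiv_of_entails fun q => ?_)
    ((subst t).trans (define _ t hz₂ hzt).symm))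
  simp only [holdsB_cons, BuiltIn.Holds, and_congr_left_iff]
  intro hq
  rw [h q hq]

/-- User-defined constraints that the store entails to name the same ground atom are
interchangeable. -/
theorem aequiv_replace {U : Multiset (UserConstraint L S)} {D : Multiset (BuiltIn L)}
    {X : Finset ℕ} {c c' : UserConstraint L S}
    (h : ∀ q : Point CT, HoldsB q.val D → c.eval q.val = c'.eval q.val) :
    AEquiv CT (⟨c ::ₘ U, D, X⟩ : State L S) ⟨c' ::ₘ U, D, X⟩ := by
  classical
  by_cases hD : ∃ q : Point CT, HoldsB q.val D
  swap
  · exact aequiv_of_inconsistent fun q hq => hD ⟨q, hq⟩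
  obtain ⟨k, p, ts⟩ := c
  obtain ⟨k', p', ts'⟩ := c'
  obtain ⟨q₀, hq₀⟩ := hD
  have h₀ := h q₀ hq₀
  simp only [UserConstraint.eval, Sigma.mk.injEq] at h₀
  obtain ⟨rfl, h₀⟩ := h₀
  simp only [heq_eq_eq, Prod.mk.injEq] at h₀
  obtain ⟨rfl, -⟩ := h₀
  have harg : ∀ i, ∀ q : Point CT, HoldsB q.val D →
      (ts i).realize q.val = (ts' i).realize q.val := by
    intro i q hq
    have := h q hq
    simp only [UserConstraint.eval, Sigma.mk.injEq, heq_eq_eq, Prod.mk.injEq, true_and] at this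
    exact congrFun this i
  have key : ∀ A : Finset (Fin k), AEquiv CT (⟨⟨k, p, ts⟩ ::ₘ U, D, X⟩ : State L S)
      ⟨⟨k, p, A.piecewise ts' ts⟩ ::ₘ U, D, X⟩ := by
    intro A
    induction A using Finset.induction_on with
    | empty => simpa using AEquiv.rfl
    | insert i A hi ih =>
      refine ih.trans ?_
      rw [Finset.piecewise_insert]
      refine aequiv_update_arg p _ i (ts' i) fun q hq => ?_
      rw [Finset.piecewise_eq_of_notMem _ _ _ hi]
      exact harg i q hq
  simpa using key Finset.univ

theorem aequiv_replace_map {α : Type*} (K : Multiset α) (f g : α → UserConstraint L S)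
    {U : Multiset (UserConstraint L S)} {D : Multiset (BuiltIn L)} {X : Finset ℕ}
    (h : ∀ a ∈ K, ∀ q : Point CT, HoldsB q.val D → (f a).eval q.val = (g a).eval q.val) :
    AEquiv CT (⟨K.map f + U, D, X⟩ : State L S) ⟨K.map g + U, D, X⟩ := by
  induction K using Multiset.induction_on generalizing U with
  | empty => simpa using AEquiv.rfl
  | cons a K ih =>
    simp only [Multiset.map_cons, Multiset.cons_add]
    refine (aequiv_replace (h a (Multiset.mem_cons_self a K))).trans ?_
    simp only [← Multiset.add_cons]
    exact ih fun b hb => h b (Multiset.mem_cons_of_mem hb)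

/-- The equations `ρ x = v x` for `x ∈ F`. -/
def renamingEqs (L : FirstOrder.Language.{u, u}) (ρ v : ℕ → ℕ) (F : Finset ℕ) :
    Multiset (BuiltIn L) :=
  F.val.map fun x => BuiltIn.eq (Term.var (ρ x)) (Term.var (v x))

theorem holdsB_renamingEqs {M : Type u} [L.Structure M] {ρ v : ℕ → ℕ} {F : Finset ℕ}
    {w : ℕ → M} : HoldsB w (renamingEqs L ρ v F) ↔ ∀ x ∈ F, w (ρ x) = w (v x) := by
  simp [HoldsB, renamingEqs, BuiltIn.Holds]

theorem fvB_renamingEqs {ρ v : ℕ → ℕ} {F : Finset ℕ} :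
    fvB (renamingEqs L ρ v F) = ρ '' F ∪ v '' F := by
  ext x
  simp [fvB, renamingEqs, BuiltIn.fv, Term.varFinset]
  grind

theorem exists_perm_fresh {V A : Set ℕ} (hV : V.Finite) (hA : A.Finite) :
    ∃ ρ : Equiv.Perm ℕ, ∀ x ∈ V, ρ x ∉ A := by
  obtain ⟨N, hN⟩ := (hV.union hA).bddAbove
  have hN' : ∀ x ∈ V ∪ A, x < N + 1 := fun x hx => Nat.lt_succ_of_le (hN hx)
  -- The involution exchanging `x` and `x + (N + 1)` for `x ≤ N`.
  let f : ℕ → ℕ := fun x => if x < N + 1 then x + (N + 1) else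
    if x < 2 * (N + 1) then x - (N + 1) else x
  have hf : Function.Involutive f := by
    intro x
    simp only [f]
    split_ifs <;> omega
  refine ⟨hf.toPerm, fun x hx hxA => ?_⟩
  have h₁ := hN' x (.inl hx)
  have h₂ := hN' _ (.inr hxA)
  simp only [Function.Involutive.coe_toPerm, f, if_pos h₁] at h₂
  omega

/-- If the store `C` entails `∃ u. (u = v on F) ∧ G`, then a copy of `G` with fresh variables `ρ x`,
equated with `v x` for `x ∈ F`, may be added to the store. -/
theorem aequiv_add_instance {U : Multiset (UserConstraint L S)} {C G : Multiset (BuiltIn L)}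
    {X : Finset ℕ} {V : Set ℕ} (hG : fvB G ⊆ V) {F : Finset ℕ} (hF : ↑F ⊆ V) {v : ℕ → ℕ}
    {ρ : Equiv.Perm ℕ} (hρ : ∀ x ∈ V, ρ x ∉ fvU U ∪ fvB C ∪ X ∪ v '' V)
    (h : ∀ p : Point CT, HoldsB p.val C →
      ∃ u : ℕ → p.carrier, (∀ x ∈ F, u x = p.val (v x)) ∧ HoldsB u G) :
    AEquiv CT (⟨U, C, X⟩ : State L S)
      ⟨U, G.map (BuiltIn.rename ρ) + (renamingEqs L ρ v F + C), X⟩ := by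
  classical
  refine aequiv_transform (fun p hp => ?_)
    fun p hp => ⟨p.val, fun _ _ => rfl, (holdsB_add.1 (holdsB_add.1 hp).2).2⟩
  obtain ⟨u, hu, huG⟩ := h p hp
  let w : ℕ → p.carrier := fun y => if ρ.symm y ∈ V then u (ρ.symm y) else p.val y
  have hw : ∀ y ∈ fvU U ∪ fvB C ∪ X ∪ v '' V, w y = p.val y := by
    intro y hy
    refine if_neg fun hV => hρ _ hV ?_
    rwa [Equiv.apply_symm_apply]
  have hwρ : ∀ x ∈ V, w (ρ x) = u x := by
    intro x hx
    simp [w, hx]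
  refine ⟨w, fun x hx => hw x ?_, ?_⟩
  · rcases hx with hx | hx
    exacts [.inl (.inl (.inl hx)), .inl (.inr hx)]
  · simp only [holdsB_add, holdsB_rename, holdsB_renamingEqs]
    refine ⟨(holdsB_congr fun x hx => hwρ x (hG hx)).2 huG, fun x hx => ?_,
      (holdsB_congr fun x hx => hw x (.inl (.inl (.inr hx)))).2 hp⟩
    rw [hwρ x (hF hx), hu x hx, hw _ (.inr ⟨x, hF hx, rfl⟩)]

end Equivalences

/-! ### Growing states inside the coinductive semantics -/

section Extension

variable {CT : ConstraintTheory L} {P : Program L S}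

theorem coinductiveSemantics_of_step {σ τ : State L S} (hσ : σ ∈ coinductiveSemantics CT P)
    (h : Step (AEquiv CT) P σ τ) : τ ∈ coinductiveSemantics CT P := by
  rw [coinductiveSemantics, ← OrderHom.map_gfp] at hσ
  exact hσ.1 τ h

theorem coinductiveSemantics_of_aequiv {σ τ : State L S} (hσ : σ ∈ coinductiveSemantics CT P)
    (h : AEquiv CT σ τ) : τ ∈ coinductiveSemantics CT P := by
  rw [coinductiveSemantics, ← OrderHom.map_gfp] at hσ ⊢
  exact ⟨fun υ hυ => hσ.1 υ (hυ.congr h .rfl), fun hf => hσ.2 (hf.trans h.symm)⟩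

theorem consistent_of_mem_coinductiveSemantics {U : Multiset (UserConstraint L S)}
    {C : Multiset (BuiltIn L)} {X : Finset ℕ}
    (h : (⟨U, C, X⟩ : State L S) ∈ coinductiveSemantics CT P) :
    ∃ p : Point CT, HoldsB p.val C := by
  by_contra! hC
  rw [coinductiveSemantics, ← OrderHom.map_gfp] at h
  exact h.2 (failure_aequiv_of_inconsistent hC)

/-- A forcing condition: a pair `(U, C)` of constraint stores such that `⟨n • U; C; X⟩` belongs to
the coinductive semantics of `P ^ n`, ordered by growing stores. -/
abbrev Condition (CT : ConstraintTheory L) (P : Program L S) (n : ℕ) (X : Finset ℕ) : Type u :=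
  {s : Multiset (UserConstraint L S) × Multiset (BuiltIn L) //
    (⟨n • s.1, s.2, X⟩ : State L S) ∈ coinductiveSemantics CT (P.scale n)}

variable {n : ℕ} {X : Finset ℕ}

/-- The built-in store of a condition entails `φ`. -/
def Condition.Forces (s : Condition CT P n X) (φ : Point CT → Prop) : Prop :=
  ∀ p : Point CT, HoldsB p.val s.1.2 → φ p

theorem Condition.Forces.mono {s t : Condition CT P n X} (hst : s ≤ t) {φ : Point CT → Prop}
    (h : s.Forces φ) : t.Forces φ :=
  fun p hp => h p fun d hd => hp d (Multiset.mem_of_le hst.2 hd)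

/-- The conclusion of an axiom whose premise is entailed may be added to the store, with fresh names
for the existentially quantified variables. -/
theorem Condition.exists_ge_of_coherent (s : Condition CT P n X) {a : CoherentFormula L}
    (ha : ∀ p : Point CT, a.Holds p.carrier) {v : ℕ → ℕ}
    (hv : s.Forces fun p => HoldsB (p.val ∘ v) a.premise) :
    ∃ t : Condition CT P n X, s ≤ t ∧ ∃ w : ℕ → ℕ,
      (∀ x ∉ a.exVars, t.Forces fun p => p.val (w x) = p.val (v x)) ∧
      t.Forces fun p => HoldsB (p.val ∘ w) a.conclusion := by
  classical
  obtain ⟨⟨U, C⟩, hs⟩ := s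
  have hVf : (fvB a.conclusion).Finite := finite_fvB _
  obtain ⟨ρ, hρ⟩ := exists_perm_fresh hVf
    ((((finite_fvU (n • U)).union (finite_fvB C)).union X.finite_toSet).union (hVf.image v))
  let F : Finset ℕ := hVf.toFinset \ a.exVars
  have hF : (F : Set ℕ) ⊆ fvB a.conclusion := by intro x; simp +contextual [F]
  have hadd := aequiv_add_instance (G := a.conclusion) subset_rfl hF hρ fun p hp => by
    obtain ⟨u, hu, huc⟩ := ha p (p.val ∘ v) (hv p hp)
    exact ⟨u, fun x hx => hu x (Finset.mem_sdiff.1 hx).2, huc⟩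
  refine ⟨⟨(U, _), coinductiveSemantics_of_aequiv hs hadd⟩, ⟨le_rfl, ?_⟩,
    fun x => if x ∈ fvB a.conclusion then ρ x else v x, fun x hx p hp => ?_, fun p hp => ?_⟩
  · exact (Multiset.le_add_left _ _).trans (Multiset.le_add_left _ _)
  · simp only [holdsB_add, holdsB_renamingEqs] at hp
    dsimp only
    split_ifs with hxV
    · exact hp.2.1 x (by simp [F, hx, hxV])
    · rfl
  · simp only [holdsB_add, holdsB_rename] at hp
    refine (holdsB_congr fun x hx => ?_).1 hp.1
    simp [hx]

/-- A rule fires on a condition as soon as its head is matched in the user store and its guard is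
entailed. Since every constraint is present `n` times, even heads several of whose constraints match
the same stored constraint can be applied. -/
theorem Condition.exists_ge_of_rule (s : Condition CT P n X) {r : Rule L S} (hr : r ∈ P.rules)
    (hprop : r.IsPropagation) (hn : r.headSize < n) {v : ℕ → ℕ}
    (hK : ∀ c ∈ r.kept, ∃ c' ∈ s.1.1, s.Forces fun p => c.eval (p.val ∘ v) = c'.eval p.val)
    (hG : s.Forces fun p => HoldsB (p.val ∘ v) r.guard) :
    ∃ t : Condition CT P n X, s ≤ t ∧ ∃ w : ℕ → ℕ,
      (∀ x ∈ fvU r.kept, t.Forces fun p => p.val (w x) = p.val (v x)) ∧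
      (t.Forces fun p => HoldsB (p.val ∘ w) r.guard ∧ HoldsB (p.val ∘ w) r.bodyB) ∧
      ∀ c ∈ r.bodyU, ∃ c' ∈ t.1.1, t.Forces fun p => c.eval (p.val ∘ w) = c'.eval p.val := by
  classical
  obtain ⟨⟨U, C⟩, hs⟩ := s
  have hrem : r.removed = 0 := hprop
  choose! m hmU hm using hK
  have hle : r.kept.map m ≤ n • U := by
    refine Multiset.le_iff_count.2 fun c => ?_
    by_cases hc : c ∈ r.kept.map m
    · have hcU : c ∈ U := by
        obtain ⟨d, hd, rfl⟩ := Multiset.mem_map.1 hc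
        exact hmU d hd
      calc Multiset.count c (r.kept.map m) ≤ (r.kept.map m).card := Multiset.count_le_card _ _
        _ = r.headSize := by simp [Rule.headSize, hrem]
        _ ≤ n := hn.le
        _ ≤ n * Multiset.count c U :=
          Nat.le_mul_of_pos_right n (Multiset.count_pos.2 hcU)
        _ = Multiset.count c (n • U) := (Multiset.count_nsmul _ _ _).symm
    · rw [Multiset.count_eq_zero_of_notMem hc]
      exact Nat.zero_le _
  obtain ⟨D, hD⟩ := Multiset.le_iff_exists_add.1 hle
  let V : Set ℕ := fvU r.kept ∪ fvB r.guard ∪ fvB r.bodyB ∪ fvU r.bodyU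
  have hVf : V.Finite := (((finite_fvU _).union (finite_fvB _)).union (finite_fvB _)).union
    (finite_fvU _)
  obtain ⟨ρ, hρ⟩ := exists_perm_fresh hVf
    ((((finite_fvU (n • U)).union (finite_fvB C)).union X.finite_toSet).union (hVf.image v))
  let F : Finset ℕ := (finite_fvU r.kept).toFinset
  have hF : (F : Set ℕ) ⊆ V := by intro x hx; simp [F] at hx; simp [V, hx]
  have hGV : fvB r.guard ⊆ V := by intro x hx; simp [V, hx]
  let E : Multiset (BuiltIn L) := renamingEqs L ρ v F + C
  have hadd : AEquiv CT (⟨n • U, C, X⟩ : State L S)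
      ⟨n • U, r.guard.map (BuiltIn.rename ρ) + E, X⟩ :=
    aequiv_add_instance hGV hF hρ fun p hp => ⟨p.val ∘ v, fun _ _ => rfl, hG p hp⟩
  have hev : ∀ c ∈ r.kept, ∀ q : Point CT, HoldsB q.val E →
      (m c).eval q.val = (c.rename ρ).eval q.val := by
    intro c hc q hq
    simp only [E, holdsB_add, holdsB_renamingEqs] at hq
    rw [← hm c hc q hq.2, UserConstraint.eval_rename]
    refine (c.eval_congr fun x hx => ?_).symm
    exact hq.1 x (by simpa [F] using ⟨c, hc, hx⟩)
  have hmatch : AEquiv CT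
      (⟨n • U, r.guard.map (BuiltIn.rename ρ) + E, X⟩ : State L S)
      ⟨r.kept.map (UserConstraint.rename ρ) + D, r.guard.map (BuiltIn.rename ρ) + E, X⟩ := by
    rw [hD]
    exact aequiv_replace_map _ _ _ fun c hc q hq => hev c hc q (holdsB_add.1 hq).2
  have hfresh : Disjoint ((r.scale n).rename ρ).lv (fvU D ∪ fvB E ∪ X) := by
    refine Set.disjoint_left.2 fun y hy hyA => ?_
    have hy' : y ∈ ρ '' V \ ρ '' fvU r.kept := by
      simp only [Rule.lv, Rule.rename, Rule.scale, hrem, Multiset.map_zero, add_zero,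
        fvB_rename, fvU_rename, ← Set.image_union] at hy
      refine ⟨Set.image_mono (fun x hx => ?_) hy.1, hy.2⟩
      have := fvU_nsmul_subset n r.bodyU
      simp only [Set.mem_union, V] at hx ⊢
      tauto
    obtain ⟨⟨x, hxV, rfl⟩, hxK⟩ := hy'
    have hDU : fvU D ⊆ fvU (n • U) := by rw [hD, fvU_add]; exact Set.subset_union_right
    have hx := hρ x hxV
    have hvV : v '' F ⊆ v '' V := Set.image_mono hF
    have hFx : ρ x ∉ ρ '' F := by simpa [F] using hxK
    simp only [E, fvB_add, fvB_renamingEqs, Set.mem_union] at hyA hx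
    rcases hyA with (h | ((h | h) | h)) | h
    · exact hx (.inl (.inl (.inl (hDU h))))
    · exact hFx h
    · exact hx (.inr (hvV h))
    · exact hx (.inl (.inl (.inr h)))
    · exact hx (.inl (.inr h))
  have hstep := Step.apply (equiv := AEquiv CT) (P := P.scale n) (r.scale n) ⟨r, hr, rfl⟩ ρ _ rfl
    D E X hfresh
  simp only [Rule.rename, Rule.scale, hrem, Multiset.map_zero, add_zero] at hstep
  have hback : AEquiv CT
      (⟨(n • r.bodyU).map (UserConstraint.rename ρ) + r.kept.map (UserConstraint.rename ρ) + D,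
        r.bodyB.map (BuiltIn.rename ρ) + r.guard.map (BuiltIn.rename ρ) + E, X⟩ : State L S)
      ⟨n • (r.bodyU.map (UserConstraint.rename ρ) + U),
        r.bodyB.map (BuiltIn.rename ρ) + r.guard.map (BuiltIn.rename ρ) + E, X⟩ := by
    rw [Multiset.map_nsmul, nsmul_add, hD, add_right_comm, add_comm _ (r.kept.map _),
      add_left_comm _ (r.kept.map m)]
    exact (aequiv_replace_map _ _ _ fun c hc q hq => hev c hc q (holdsB_add.1 hq).2).symm
  have hmem := coinductiveSemantics_of_aequiv (coinductiveSemantics_of_step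
    (coinductiveSemantics_of_aequiv (coinductiveSemantics_of_aequiv hs hadd) hmatch) hstep) hback
  refine ⟨⟨(_, _), hmem⟩, ⟨Multiset.le_add_left _ _, ?_⟩, ρ, fun x hx p hp => ?_,
    fun p hp => ?_, fun c hc => ⟨c.rename ρ, ?_, fun p _ => (c.eval_rename ρ).symm⟩⟩
  · exact (Multiset.le_add_left _ _).trans (Multiset.le_add_left _ _)
  · simp only [E, holdsB_add, holdsB_renamingEqs] at hp
    exact hp.2.1 x (by simpa [F] using hx)
  · simp only [holdsB_add, holdsB_rename] at hp
    exact ⟨hp.1.2, hp.1.1⟩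
  · exact Multiset.mem_add.2 (.inl (Multiset.mem_map_of_mem _ hc))

end Extension

/-! ### Generic ideals of conditions -/

/-- A form of the Rasiowa–Sikorski lemma: if every element at which `prem i` holds can be enlarged
so that `concl i` holds, then some ideal is closed under all these implications. The cofinal sets
consist of the elements at which `concl i` holds or above which `prem i` never holds. -/
theorem exists_ideal_closed {α ι : Type*} [Preorder α] [Countable ι] {prem concl : ι → α → Prop}
    (hprem : ∀ i s t, s ≤ t → prem i s → prem i t)
    (h : ∀ i s, prem i s → ∃ t, s ≤ t ∧ concl i t) (s₀ : α) :
    ∃ J : Order.Ideal α, s₀ ∈ J ∧ ∀ i, (∃ s ∈ J, prem i s) → ∃ t ∈ J, concl i t := by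
  have := Encodable.ofCountable ι
  let D : ι → Order.Cofinal α := fun i =>
    { carrier := {s | concl i s ∨ ∀ t, s ≤ t → ¬ prem i t}
      isCofinal := fun s => by
        by_cases hs : ∃ t, s ≤ t ∧ prem i t
        · obtain ⟨t, hst, ht⟩ := hs
          obtain ⟨t', htt', ht'⟩ := h i t ht
          exact ⟨t', .inl ht', hst.trans htt'⟩
        · push Not at hs
          exact ⟨s, .inr hs, le_rfl⟩ }
  refine ⟨Order.idealOfCofinals s₀ D, Order.mem_idealOfCofinals s₀ D, fun i ⟨s, hs, hps⟩ => ?_⟩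
  obtain ⟨t, htD, ht⟩ := Order.cofinal_meets_idealOfCofinals s₀ D i
  refine ⟨t, ht, htD.resolve_right fun hno => ?_⟩
  obtain ⟨t', -, hst', htt'⟩ := (Order.idealOfCofinals s₀ D).directed s hs t ht
  exact hno t' htt' (hprem i s t' hst' hps)

theorem exists_mem_ideal_forall {α β : Type*} [Preorder α] (J : Order.Ideal α) {K : Multiset β}
    {Q : β → α → Prop} (hQ : ∀ b s t, s ≤ t → Q b s → Q b t) (h : ∀ b ∈ K, ∃ s ∈ J, Q b s) :
    ∃ s ∈ J, ∀ b ∈ K, Q b s := by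
  induction K using Multiset.induction_on with
  | empty =>
    obtain ⟨s, hs⟩ := J.nonempty
    exact ⟨s, hs, by simp⟩
  | cons b K ih =>
    obtain ⟨s, hs, hsb⟩ := h b (Multiset.mem_cons_self b K)
    obtain ⟨t, ht, htK⟩ := ih fun c hc => h c (Multiset.mem_cons_of_mem hc)
    obtain ⟨s', hs', hss', hts'⟩ := J.directed s hs t ht
    refine ⟨s', hs', fun c hc => ?_⟩
    rcases Multiset.mem_cons.1 hc with rfl | hc
    exacts [hQ _ _ _ hss' hsb, hQ _ _ _ hts' (htK c hc)]

section Generic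

variable {CT : ConstraintTheory L} {P : Program L S} {n : ℕ} {X : Finset ℕ}

/-- The filter of properties of points that are entailed by some condition in the ideal `J`. -/
def genericFilter (J : Order.Ideal (Condition CT P n X)) : Filter (Point CT) where
  sets := {A | ∃ s ∈ J, s.Forces (· ∈ A)}
  univ_sets := J.nonempty.imp fun _ hs => ⟨hs, fun _ _ => trivial⟩
  sets_of_superset := fun ⟨s, hs, h⟩ hAB => ⟨s, hs, fun p hp => hAB (h p hp)⟩
  inter_sets := fun ⟨s, hs, hsA⟩ ⟨t, ht, htB⟩ => by
    obtain ⟨s', hs', hss', hts'⟩ := J.directed s hs t ht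
    exact ⟨s', hs', fun p hp => ⟨hsA.mono hss' p hp, htB.mono hts' p hp⟩⟩

/-- The user-defined constraints that occur in some condition in the ideal `J`. -/
def storedConstraints (J : Order.Ideal (Condition CT P n X)) : Set (UserConstraint L S) :=
  {c | ∃ s ∈ J, c ∈ s.1.1}

instance (J : Order.Ideal (Condition CT P n X)) : (genericFilter J).NeBot := by
  refine Filter.neBot_iff.2 fun h => ?_
  obtain ⟨s, -, hs⟩ := (Filter.empty_mem_iff_bot.2 h : ∅ ∈ genericFilter J)
  obtain ⟨p, hp⟩ := consistent_of_mem_coinductiveSemantics s.2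
  exact hs p hp

/-- Entailed instances of the premise of `a` have entailed instances of its conclusion. -/
def AxiomSaturated (𝓕 : Filter (Point CT)) (a : CoherentFormula L) : Prop :=
  ∀ v : ℕ → ℕ, (∀ᶠ p in 𝓕, HoldsB (p.val ∘ v) a.premise) →
    ∃ w : ℕ → ℕ, (∀ x ∉ a.exVars, ∀ᶠ p in 𝓕, p.val (w x) = p.val (v x)) ∧
      ∀ᶠ p in 𝓕, HoldsB (p.val ∘ w) a.conclusion

/-- The constraint `c`, with its variables renamed by `v`, is entailed to be one of those in `U`. -/
def Stored (𝓕 : Filter (Point CT)) (U : Set (UserConstraint L S)) (v : ℕ → ℕ)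
    (c : UserConstraint L S) : Prop :=
  ∃ c' ∈ U, ∀ᶠ p in 𝓕, c.eval (p.val ∘ v) = c'.eval p.val

/-- Whenever the head of `r` is stored and its guard entailed, so is an instance of its body. -/
def RuleSaturated (𝓕 : Filter (Point CT)) (U : Set (UserConstraint L S)) (r : Rule L S) : Prop :=
  ∀ v : ℕ → ℕ, (∀ c ∈ r.kept, Stored 𝓕 U v c) → (∀ᶠ p in 𝓕, HoldsB (p.val ∘ v) r.guard) →
    ∃ w : ℕ → ℕ, (∀ x ∈ fvU r.kept, ∀ᶠ p in 𝓕, p.val (w x) = p.val (v x)) ∧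
      (∀ᶠ p in 𝓕, HoldsB (p.val ∘ w) r.guard ∧ HoldsB (p.val ∘ w) r.bodyB) ∧
      ∀ c ∈ r.bodyU, Stored 𝓕 U w c

theorem exists_finsupp_eqOn {V : Set ℕ} (hV : V.Finite) (v : ℕ → ℕ) :
    ∃ f : ℕ →₀ ℕ, ∀ x ∈ V, f x = v x :=
  ⟨Finsupp.indicator hV.toFinset fun x _ => v x, fun _ hx =>
    Finsupp.indicator_of_mem (hV.mem_toFinset.2 hx) _⟩

/-- Every condition lies in an ideal that is saturated for countably many valid coherent formulas
and for the rules of the program. -/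
theorem exists_saturated_ideal (hP : P.IsCPR) (hn : ∀ r ∈ P.rules, r.headSize < n)
    {A : Set (CoherentFormula L)} (hA : A.Countable)
    (hCT : ∀ a ∈ A, ∀ p : Point CT, a.Holds p.carrier) (s₀ : Condition CT P n X) :
    ∃ J : Order.Ideal (Condition CT P n X), s₀ ∈ J ∧
      (∀ a ∈ A, AxiomSaturated (genericFilter J) a) ∧
      ∀ r ∈ P.rules, RuleSaturated (genericFilter J) (storedConstraints J) r := by
  classical
  have := hA.to_subtype
  have := P.finite.countable.to_subtype
  -- Only finitely many values of a variable assignment matter for an axiom or rule, so it is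
  -- enough to consider the countably many finitely supported ones.
  let ι := (A ⊕ P.rules) × (ℕ →₀ ℕ)
  let prem : ι → Condition CT P n X → Prop
    | (.inl a, v), s => s.Forces fun p => HoldsB (p.val ∘ v) a.1.premise
    | (.inr r, v), s =>
      (∀ c ∈ r.1.kept, ∃ c' ∈ s.1.1, s.Forces fun p => c.eval (p.val ∘ v) = c'.eval p.val) ∧
        s.Forces fun p => HoldsB (p.val ∘ v) r.1.guard
  let concl : ι → Condition CT P n X → Prop
    | (.inl a, v), t => ∃ w : ℕ → ℕ,
      (∀ x ∉ a.1.exVars, t.Forces fun p => p.val (w x) = p.val (v x)) ∧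
      t.Forces fun p => HoldsB (p.val ∘ w) a.1.conclusion
    | (.inr r, v), t => ∃ w : ℕ → ℕ,
      (∀ x ∈ fvU r.1.kept, t.Forces fun p => p.val (w x) = p.val (v x)) ∧
      (t.Forces fun p => HoldsB (p.val ∘ w) r.1.guard ∧ HoldsB (p.val ∘ w) r.1.bodyB) ∧
      ∀ c ∈ r.1.bodyU, ∃ c' ∈ t.1.1, t.Forces fun p => c.eval (p.val ∘ w) = c'.eval p.val
  have hstored : ∀ (v : ℕ → ℕ) (c : UserConstraint L S) (s t : Condition CT P n X), s ≤ t →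
      (∃ c' ∈ s.1.1, s.Forces fun p => c.eval (p.val ∘ v) = c'.eval p.val) →
      ∃ c' ∈ t.1.1, t.Forces fun p => c.eval (p.val ∘ v) = c'.eval p.val :=
    fun v c s t hst ⟨c', hc', h⟩ => ⟨c', Multiset.mem_of_le hst.1 hc', h.mono hst⟩
  obtain ⟨J, hs₀, hJ⟩ := exists_ideal_closed (ι := ι) (prem := prem) (concl := concl)
    (by
      rintro ⟨a | r, v⟩ s t hst h
      · exact Condition.Forces.mono hst h
      · exact ⟨fun c hc => hstored v c s t hst (h.1 c hc), h.2.mono hst⟩)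
    (by
      rintro ⟨a | r, v⟩ s h
      · exact s.exists_ge_of_coherent (hCT a.1 a.2) h
      · exact s.exists_ge_of_rule r.2 (hP r.1 r.2) (hn r.1 r.2) h.1 h.2) s₀
  refine ⟨J, hs₀, fun a ha v hv => ?_, fun r hr v hK hG => ?_⟩
  · obtain ⟨f, hf⟩ :=
      exists_finsupp_eqOn ((finite_fvB a.premise).union (finite_fvB a.conclusion)) v
    obtain ⟨s, hs, hv⟩ := hv
    obtain ⟨t, ht, w, hw, hwc⟩ := hJ (.inl ⟨a, ha⟩, f) ⟨s, hs, fun p hp =>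
      (holdsB_congr fun x hx => by simp [hf x (.inl hx)]).1 (hv p hp)⟩
    refine ⟨fun x => if x ∈ fvB a.conclusion then w x else v x, fun x hx => ⟨t, ht, fun p hp => ?_⟩,
      ⟨t, ht, fun p hp => (holdsB_congr fun x hx => ?_).1 (hwc p hp)⟩⟩
    · by_cases hxV : x ∈ fvB a.conclusion
      · simpa [hxV, hf x (.inr hxV)] using hw x hx p hp
      · simp [hxV]
    · simp [hx]
  · obtain ⟨f, hf⟩ := exists_finsupp_eqOn ((finite_fvU r.kept).union (finite_fvB r.guard)) v
    obtain ⟨s, hs, hsG⟩ := hG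
    obtain ⟨t, ht, htK⟩ := exists_mem_ideal_forall J (K := r.kept) (hstored v) fun c hc => by
      obtain ⟨c', ⟨t, ht, hc't⟩, t', ht', h⟩ := hK c hc
      obtain ⟨t'', ht'', h₁, h₂⟩ := J.directed t ht t' ht'
      exact ⟨t'', ht'', c', Multiset.mem_of_le h₁.1 hc't, Condition.Forces.mono h₂ h⟩
    obtain ⟨s', hs', hss', hts'⟩ := J.directed s hs t ht
    obtain ⟨t', ht', w, hw, hwG, hwB⟩ := hJ (.inr ⟨r, hr⟩, f) ⟨s', hs', by
      constructor
      · intro c hc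
        obtain ⟨c', hc', h⟩ := hstored v c t s' hts' (htK c hc)
        refine ⟨c', hc', fun p hp => (c.eval_congr fun x hx => ?_).trans (h p hp)⟩
        simp [hf x (.inl ⟨c, hc, hx⟩)]
      · exact fun p hp => (holdsB_congr fun x hx => by simp [hf x (.inr hx)]).1
          (Condition.Forces.mono hss' hsG p hp)⟩
    refine ⟨w, fun x hx => ⟨t', ht', fun p hp => ?_⟩, ⟨t', ht', hwG⟩, fun c hc => ?_⟩
    · rw [← hf x (.inl hx)]
      exact hw x hx p hp
    · obtain ⟨c', hc', h⟩ := hwB c hc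
      exact ⟨c', ⟨t', ht', hc'⟩, t', ht', h⟩

end Generic

/-! ### Function symbols -/

/-- The function symbols occurring in a term. -/
def termFunctions : L.Term ℕ → Set (Σ k, L.Functions k)
  | .var _ => ∅
  | .func (l := k) f ts => insert ⟨k, f⟩ (⋃ i, termFunctions (ts i))

/-- The function symbols occurring in a built-in constraint. -/
def BuiltIn.functions : BuiltIn L → Set (Σ k, L.Functions k)
  | .verum => ∅
  | .falsum => ∅
  | .eq s t => termFunctions s ∪ termFunctions t
  | .rel _ ts => ⋃ i, termFunctions (ts i)

/-- The function symbols occurring in a user-defined constraint. -/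
def UserConstraint.functions (c : UserConstraint L S) : Set (Σ k, L.Functions k) :=
  ⋃ i, termFunctions (c.args i)

/-- The function symbols occurring in a conjunction of built-in constraints. -/
def functionsB (D : Multiset (BuiltIn L)) : Set (Σ k, L.Functions k) :=
  ⋃ d : {d // d ∈ D}, d.1.functions

/-- The function symbols occurring in a multiset of user-defined constraints. -/
def functionsU (C : Multiset (UserConstraint L S)) : Set (Σ k, L.Functions k) :=
  ⋃ c : {c // c ∈ C}, c.1.functions

/-- The function symbols occurring in a rule. -/
def Rule.functions (r : Rule L S) : Set (Σ k, L.Functions k) :=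
  functionsU r.kept ∪ functionsB r.guard ∪ functionsB r.bodyB ∪ functionsU r.bodyU

/-- The function symbols occurring in a coherent formula. -/
def CoherentFormula.functions (a : CoherentFormula L) : Set (Σ k, L.Functions k) :=
  functionsB a.premise ∪ functionsB a.conclusion

theorem countable_termFunctions (t : L.Term ℕ) : (termFunctions t).Countable := by
  induction t with
  | var => exact Set.countable_empty
  | func f ts ih => exact (Set.countable_iUnion ih).insert _

theorem BuiltIn.countable_functions (d : BuiltIn L) : d.functions.Countable := by
  cases d with
  | verum => exact Set.countable_empty
  | falsum => exact Set.countable_empty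
  | eq s t => exact (countable_termFunctions s).union (countable_termFunctions t)
  | rel R ts => exact Set.countable_iUnion fun i => countable_termFunctions (ts i)

theorem countable_mem {α : Type*} (D : Multiset α) : Countable {d // d ∈ D} := by
  classical
  exact ((Finset.countable_toSet D.toFinset).mono fun d hd => by simpa using hd :
    {d | d ∈ D}.Countable).to_subtype

theorem countable_functionsB (D : Multiset (BuiltIn L)) : (functionsB D).Countable :=
  have := countable_mem D
  Set.countable_iUnion fun d => d.1.countable_functions

theorem countable_functionsU (C : Multiset (UserConstraint L S)) : (functionsU C).Countable :=
  have := countable_mem C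
  Set.countable_iUnion fun c => Set.countable_iUnion fun i => countable_termFunctions (c.1.args i)

theorem Rule.countable_functions (r : Rule L S) : r.functions.Countable :=
  (((countable_functionsU _).union (countable_functionsB _)).union (countable_functionsB _)).union
    (countable_functionsU _)

theorem CoherentFormula.countable_functions (a : CoherentFormula L) : a.functions.Countable :=
  (countable_functionsB _).union (countable_functionsB _)

/-! ### The generic model -/

section GenericModel

variable {CT : ConstraintTheory L} (𝓕 : Filter (Point CT))

/-- Variables are identified when they are entailed to be equal. -/
def genericSetoid : Setoid (ULift.{u} ℕ) where
  r x y := ∀ᶠ p in 𝓕, p.val x.down = p.val y.down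
  iseqv :=
    { refl := fun _ => .of_forall fun _ => rfl
      symm := fun h => h.mono fun _ => Eq.symm
      trans := fun h h' => by filter_upwards [h, h'] with p h₁ h₂ using h₁.trans h₂ }

/-- The carrier of the generic model: the variables modulo entailed equality. -/
def GenericModel : Type u := Quotient (genericSetoid 𝓕)

namespace GenericModel

/-- The element named by a variable. -/
def mk (x : ℕ) : GenericModel 𝓕 := Quotient.mk (genericSetoid 𝓕) ⟨x⟩

variable {𝓕}

/-- A variable naming a given element. -/
noncomputable def name (m : GenericModel 𝓕) : ℕ := (Quotient.out m).down

@[simp] theorem mk_name (m : GenericModel 𝓕) : mk 𝓕 m.name = m := Quotient.out_eq m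

theorem mk_eq_mk {x y : ℕ} : mk 𝓕 x = mk 𝓕 y ↔ ∀ᶠ p in 𝓕, p.val x = p.val y := Quotient.eq

theorem eventually_name_mk (x : ℕ) : ∀ᶠ p in 𝓕, p.val (mk 𝓕 x).name = p.val x :=
  mk_eq_mk.1 (mk_name _)

instance : Nonempty (GenericModel 𝓕) := ⟨mk 𝓕 0⟩

open Classical in
/-- Relations hold when they are entailed. The value of a function is a variable entailed to be
equal to it; in the absence of such a variable the value is arbitrary. -/
noncomputable instance : L.Structure (GenericModel 𝓕) where
  funMap f m :=
    if h : ∃ y : ℕ, ∀ᶠ p in 𝓕, p.val y = Structure.funMap f fun i => p.val (m i).name then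
      mk 𝓕 h.choose
    else mk 𝓕 0
  RelMap R m := ∀ᶠ p in 𝓕, Structure.RelMap R fun i => p.val (m i).name

/-- Every value of `f` at variables is entailed to be equal to some variable. -/
def Total (𝓕 : Filter (Point CT)) (f : Σ k, L.Functions k) : Prop :=
  ∀ xs : Fin f.1 → ℕ, ∃ y : ℕ, ∀ᶠ p in 𝓕, p.val y = Structure.funMap f.2 fun i => p.val (xs i)

theorem exists_realize_eq_mk {t : L.Term ℕ} (ht : ∀ f ∈ termFunctions t, Total 𝓕 f) (v : ℕ → ℕ) :
    ∃ y : ℕ, t.realize (fun x => mk 𝓕 (v x)) = mk 𝓕 y ∧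
      ∀ᶠ p in 𝓕, p.val y = t.realize (p.val ∘ v) := by
  induction t with
  | var x => exact ⟨v x, rfl, .of_forall fun _ => rfl⟩
  | @func k f ts ih =>
    simp only [termFunctions, Set.mem_insert_iff, Set.mem_iUnion, forall_eq_or_imp] at ht
    choose ys hys hp using fun i => ih i fun g hg => ht.2 g ⟨i, hg⟩
    obtain ⟨y, hy⟩ := ht.1 fun i => (mk 𝓕 (ys i)).name
    have hex : ∃ y : ℕ, ∀ᶠ p in 𝓕, p.val y =
      Structure.funMap f fun i => p.val (mk 𝓕 (ys i)).name := ⟨y, hy⟩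
    refine ⟨hex.choose, ?_, ?_⟩
    · simp only [Term.realize, hys]
      exact dif_pos hex
    · filter_upwards [hex.choose_spec, Filter.eventually_all.2 hp,
        Filter.eventually_all.2 fun i => eventually_name_mk (𝓕 := 𝓕) (ys i)] with p h₁ h₂ h₃
      rw [h₁]
      simp [h₂, h₃]

theorem holds_iff [𝓕.NeBot] {d : BuiltIn L} (hd : ∀ f ∈ d.functions, Total 𝓕 f) (v : ℕ → ℕ) :
    d.Holds (fun x => mk 𝓕 (v x)) ↔ ∀ᶠ p in 𝓕, d.Holds (p.val ∘ v) := by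
  cases d with
  | verum => simp [BuiltIn.Holds]
  | falsum => simp [BuiltIn.Holds, Filter.NeBot.ne]
  | eq s t =>
    obtain ⟨y, hy, hys⟩ := exists_realize_eq_mk (fun f hf => hd f (.inl hf)) v
    obtain ⟨z, hz, hzt⟩ := exists_realize_eq_mk (fun f hf => hd f (.inr hf)) v
    simp only [BuiltIn.Holds, hy, hz, mk_eq_mk]
    refine Filter.eventually_congr ?_
    filter_upwards [hys, hzt] with p h₁ h₂
    rw [h₁, h₂]
  | rel R ts =>
    choose ys hys hp using fun i =>
      exists_realize_eq_mk (t := ts i) (fun f hf => hd f (Set.mem_iUnion.2 ⟨i, hf⟩)) v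
    simp only [BuiltIn.Holds, hys]
    refine Filter.eventually_congr ?_
    filter_upwards [Filter.eventually_all.2 hp,
      Filter.eventually_all.2 fun i => eventually_name_mk (𝓕 := 𝓕) (ys i)] with p h₂ h₃
    simp [h₂, h₃]

theorem holdsB_iff [𝓕.NeBot] {D : Multiset (BuiltIn L)} (hD : ∀ f ∈ functionsB D, Total 𝓕 f)
    (v : ℕ → ℕ) :
    HoldsB (fun x => mk 𝓕 (v x)) D ↔ ∀ᶠ p in 𝓕, HoldsB (p.val ∘ v) D := by
  classical
  have hfin : {d | d ∈ D}.Finite := (Finset.finite_toSet D.toFinset).subset fun d hd => by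
    simpa using hd
  refine Iff.trans ?_ (Filter.eventually_all_finite hfin).symm
  exact forall₂_congr fun d hd => holds_iff (fun f hf => hD f (Set.mem_iUnion.2 ⟨⟨d, hd⟩, hf⟩)) v

/-- The interpretation of the user-defined predicate symbols in the generic model: exactly the
constraints in `U` are true. -/
def interp (𝓕 : Filter (Point CT)) (U : Set (UserConstraint L S)) (k : ℕ) (p : S k)
    (m : Fin k → GenericModel 𝓕) : Prop :=
  ∃ c ∈ U, ∀ᶠ q in 𝓕, (⟨k, p, fun i => q.val (m i).name⟩ : Σ k, S k × (Fin k → q.carrier)) =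
    c.eval q.val

theorem userHolds_iff {U : Set (UserConstraint L S)} {c : UserConstraint L S}
    (hc : ∀ f ∈ c.functions, Total 𝓕 f) (v : ℕ → ℕ) :
    c.Holds (interp 𝓕 U) (fun x => mk 𝓕 (v x)) ↔ Stored 𝓕 U v c := by
  choose ys hys hp using fun i =>
    exists_realize_eq_mk (t := c.args i) (fun f hf => hc f (Set.mem_iUnion.2 ⟨i, hf⟩)) v
  simp only [UserConstraint.Holds, hys, interp, Stored]
  refine exists_congr fun c' => and_congr_right fun _ => Filter.eventually_congr ?_
  filter_upwards [Filter.eventually_all.2 hp,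
    Filter.eventually_all.2 fun i => eventually_name_mk (𝓕 := 𝓕) (ys i)] with p h₂ h₃
  simp [UserConstraint.eval, h₂, h₃]

theorem holdsU_iff {U : Set (UserConstraint L S)} {C : Multiset (UserConstraint L S)}
    (hC : ∀ f ∈ functionsU C, Total 𝓕 f) (v : ℕ → ℕ) :
    HoldsU (interp 𝓕 U) (fun x => mk 𝓕 (v x)) C ↔ ∀ c ∈ C, Stored 𝓕 U v c :=
  forall₂_congr fun c hc => userHolds_iff (fun f hf => hC f (Set.mem_iUnion.2 ⟨⟨c, hc⟩, hf⟩)) v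

theorem coherent_holds [𝓕.NeBot] {a : CoherentFormula L} (ha : AxiomSaturated 𝓕 a)
    (hf : ∀ f ∈ a.functions, Total 𝓕 f) : a.Holds (GenericModel 𝓕) := by
  intro v hv
  obtain ⟨v, rfl⟩ : ∃ v' : ℕ → ℕ, v = fun x => mk 𝓕 (v' x) := ⟨fun x => (v x).name, by simp⟩
  obtain ⟨w, hw, hwc⟩ := ha v ((holdsB_iff (fun f h => hf f (.inl h)) v).1 hv)
  exact ⟨fun x => mk 𝓕 (w x), fun x hx => mk_eq_mk.2 (hw x hx),
    (holdsB_iff (fun f h => hf f (.inr h)) w).2 hwc⟩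

theorem rule_holds [𝓕.NeBot] {U : Set (UserConstraint L S)} {r : Rule L S}
    (hprop : r.IsPropagation) (hr : RuleSaturated 𝓕 U r) (hf : ∀ f ∈ r.functions, Total 𝓕 f) :
    r.Holds (GenericModel 𝓕) (interp 𝓕 U) := by
  intro v ⟨hK, hG⟩
  obtain ⟨v, rfl⟩ : ∃ v' : ℕ → ℕ, v = fun x => mk 𝓕 (v' x) := ⟨fun x => (v x).name, by simp⟩
  obtain ⟨w, hw, hwG, hwB⟩ := hr v
    ((holdsU_iff (fun f h => hf f (.inl (.inl (.inl h)))) v).1 hK)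
    ((holdsB_iff (fun f h => hf f (.inl (.inl (.inr h)))) v).1 hG)
  have hrem : r.removed = 0 := hprop
  refine iff_of_true (by simp [hrem, HoldsU]) ⟨fun x => mk 𝓕 (w x), fun x hx => ?_, ?_, ?_, ?_⟩
  · exact mk_eq_mk.2 (hw x (by simpa [hrem] using hx))
  · exact (holdsB_iff (fun f h => hf f (.inl (.inl (.inr h)))) w).2 (hwG.mono fun _ h => h.1)
  · exact (holdsB_iff (fun f h => hf f (.inl (.inr h))) w).2 (hwG.mono fun _ h => h.2)
  · exact (holdsU_iff (fun f h => hf f (.inr h)) w).2 hwB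

end GenericModel

/-- The valid coherent formula `∃ y. y = f(x₀, …, x₍ₖ₋₁₎)`. -/
def totalityAxiom (f : Σ k, L.Functions k) : CoherentFormula L where
  premise := 0
  exVars := {f.1}
  conclusion := {BuiltIn.eq (Term.var f.1) (Term.func f.2 fun i => Term.var i)}

theorem totalityAxiom_holds (f : Σ k, L.Functions k) (M : Type u) [L.Structure M] :
    (totalityAxiom f).Holds M := by
  intro v _
  refine ⟨Function.update v f.1 (Structure.funMap f.2 fun i => v i), fun x hx => ?_, ?_⟩
  · exact Function.update_of_ne (by simpa [totalityAxiom] using hx) _ _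
  · simp only [totalityAxiom, HoldsB, Multiset.mem_singleton, forall_eq, BuiltIn.Holds,
      Term.realize, Function.update_self]
    congr 1
    funext i
    exact (Function.update_of_ne i.2.ne _ _).symm

theorem total_of_saturated {f : Σ k, L.Functions k} (h : AxiomSaturated 𝓕 (totalityAxiom f)) :
    GenericModel.Total 𝓕 f := by
  intro xs
  obtain ⟨w, hw, hwc⟩ := h (fun x => if hx : x < f.1 then xs ⟨x, hx⟩ else 0)
    (.of_forall fun _ => holdsB_zero)
  refine ⟨w f.1, ?_⟩
  have hargs : ∀ i : Fin f.1, ∀ᶠ p in 𝓕, p.val (w i) = p.val (xs i) := fun i => by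
    simpa using hw i (by simp [totalityAxiom, i.2.ne])
  filter_upwards [hwc, Filter.eventually_all.2 hargs] with p hp hargs
  simpa [totalityAxiom, HoldsB, BuiltIn.Holds, hargs] using hp

end GenericModel

/-- A state of the coinductive semantics has a model satisfying the rules and any countable part of
the constraint theory. -/
theorem satisfiableWithin_of_countable {CT : ConstraintTheory L} {P : Program L S} (hP : P.IsCPR)
    {n : ℕ} (hn : ∀ r ∈ P.rules, r.headSize < n) {E : Multiset (UserConstraint L S)}
    {C : Multiset (BuiltIn L)} {X : Finset ℕ}
    (h : (⟨n • E, C, X⟩ : State L S) ∈ coinductiveSemantics CT (P.scale n))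
    {T : ConstraintTheory L} (hT : T.Countable) (hTCT : T ⊆ CT) : SatisfiableWithin T P E C := by
  let Φ : Set (Σ k, L.Functions k) := (⋃ a ∈ T, a.functions) ∪ (⋃ r ∈ P.rules, r.functions) ∪
    functionsU E ∪ functionsB C
  have hΦ : Φ.Countable := (((hT.biUnion fun a _ => a.countable_functions).union
    (P.finite.countable.biUnion fun r _ => r.countable_functions)).union
    (countable_functionsU E)).union (countable_functionsB C)
  obtain ⟨J, hJ, hax, hrule⟩ := exists_saturated_ideal hP hn
    (hT.union (hΦ.image totalityAxiom))
    (by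
      rintro _ (ha | ⟨f, -, rfl⟩) p
      exacts [p.models _ (hTCT ha), totalityAxiom_holds f p.carrier]) ⟨(E, C), h⟩
  have htotal : ∀ f ∈ Φ, GenericModel.Total (genericFilter J) f := fun f hf =>
    total_of_saturated _ (hax _ (.inr ⟨f, hf, rfl⟩))
  refine ⟨GenericModel (genericFilter J), inferInstance, inferInstance,
    GenericModel.interp (genericFilter J) (storedConstraints J), fun a ha => ?_, fun r hr => ?_,
    GenericModel.mk (genericFilter J), ?_, ?_⟩
  · refine GenericModel.coherent_holds (hax a (.inl ha)) fun f hf => htotal f ?_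
    exact .inl (.inl (.inl (Set.mem_biUnion ha hf)))
  · refine GenericModel.rule_holds (hP r hr) (hrule r hr) fun f hf => htotal f ?_
    exact .inl (.inl (.inr (Set.mem_biUnion hr hf)))
  · refine (GenericModel.holdsU_iff (fun f hf => htotal f (.inl (.inr hf))) id).2 fun c hc => ?_
    exact ⟨c, ⟨_, hJ, hc⟩, .of_forall fun _ => rfl⟩
  · refine (GenericModel.holdsB_iff (fun f hf => htotal f (.inr hf)) id).2 ?_
    exact ⟨_, hJ, fun p hp => hp⟩

/-! ### Compactness -/

section Ultraproduct

variable {ι : Type u} {M : ι → Type u} [∀ i, L.Structure (M i)] {𝓤 : Ultrafilter ι}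

/-- The element of the ultraproduct represented by a family. -/
def ofFamily (𝓤 : Ultrafilter ι) (m : ∀ i, M i) : (𝓤 : Filter ι).Product M := m

theorem exists_ofFamily (m : (𝓤 : Filter ι).Product M) : ∃ m' : ∀ i, M i, ofFamily 𝓤 m' = m :=
  Quotient.exists_rep m

theorem ofFamily_eq {m m' : ∀ i, M i} :
    ofFamily 𝓤 m = ofFamily 𝓤 m' ↔ ∀ᶠ i in (𝓤 : Filter ι), m i = m' i := Quotient.eq

theorem realize_ofFamily (v : ℕ → ∀ i, M i) (t : L.Term ℕ) :
    t.realize (fun x => ofFamily 𝓤 (v x)) = ofFamily 𝓤 fun i => t.realize fun x => v x i :=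
  Ultraproduct.term_realize_cast v t

theorem ultraproduct_holds_iff (v : ℕ → ∀ i, M i) (d : BuiltIn L) :
    d.Holds (fun x => ofFamily 𝓤 (v x)) ↔ ∀ᶠ i in (𝓤 : Filter ι), d.Holds fun x => v x i := by
  cases d with
  | verum => simp [BuiltIn.Holds]
  | falsum => simp [BuiltIn.Holds, Filter.NeBot.ne]
  | eq s t => simp only [BuiltIn.Holds, realize_ofFamily, ofFamily_eq]
  | rel R ts =>
    simp only [BuiltIn.Holds, realize_ofFamily]
    exact @relMap_quotient_mk' L _ ((𝓤 : Filter ι).productSetoid M)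
      (Ultraproduct.setoidPrestructure M 𝓤) _ R fun j i => (ts j).realize fun x => v x i

theorem ultraproduct_holdsB_iff (v : ℕ → ∀ i, M i) (D : Multiset (BuiltIn L)) :
    HoldsB (fun x => ofFamily 𝓤 (v x)) D ↔
      ∀ᶠ i in (𝓤 : Filter ι), HoldsB (fun x => v x i) D := by
  classical
  have hfin : {d | d ∈ D}.Finite := (Finset.finite_toSet D.toFinset).subset fun d hd => by
    simpa using hd
  exact (forall₂_congr fun d _ => ultraproduct_holds_iff v d).trans
    (Filter.eventually_all_finite hfin).symm

/-- The interpretation of the user-defined predicate symbols in an ultraproduct. -/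
def ultraInterp (𝓤 : Ultrafilter ι) (I : ∀ i, ∀ k, S k → (Fin k → M i) → Prop) (k : ℕ) (p : S k)
    (m : Fin k → (𝓤 : Filter ι).Product M) : Prop :=
  ∃ m' : Fin k → ∀ i, M i, (∀ j, ofFamily 𝓤 (m' j) = m j) ∧
    ∀ᶠ i in (𝓤 : Filter ι), I i k p fun j => m' j i

theorem ultraInterp_ofFamily {I : ∀ i, ∀ k, S k → (Fin k → M i) → Prop} {k : ℕ} {p : S k}
    {m : Fin k → ∀ i, M i} :
    ultraInterp 𝓤 I k p (fun j => ofFamily 𝓤 (m j)) ↔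
      ∀ᶠ i in (𝓤 : Filter ι), I i k p fun j => m j i := by
  refine ⟨fun ⟨m', hm', h⟩ => ?_, fun h => ⟨m, fun _ => rfl, h⟩⟩
  filter_upwards [Filter.eventually_all.2 fun j => ofFamily_eq.1 (hm' j), h] with i h₁ h₂
  simpa [h₁] using h₂

theorem ultraproduct_holdsU_iff {I : ∀ i, ∀ k, S k → (Fin k → M i) → Prop} (v : ℕ → ∀ i, M i)
    (C : Multiset (UserConstraint L S)) :
    HoldsU (ultraInterp 𝓤 I) (fun x => ofFamily 𝓤 (v x)) C ↔
      ∀ᶠ i in (𝓤 : Filter ι), HoldsU (I i) (fun x => v x i) C := by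
  classical
  have hfin : {d | d ∈ C}.Finite := (Finset.finite_toSet C.toFinset).subset fun d hd => by
    simpa using hd
  refine (forall₂_congr fun c _ => ?_).trans (Filter.eventually_all_finite hfin).symm
  simp only [UserConstraint.Holds, realize_ofFamily, ultraInterp_ofFamily]

theorem exists_ofFamily_val (v : ℕ → (𝓤 : Filter ι).Product M) :
    ∃ v' : ℕ → ∀ i, M i, v = fun x => ofFamily 𝓤 (v' x) := by
  choose v' hv' using fun x => exists_ofFamily (v x)
  exact ⟨v', funext fun x => (hv' x).symm⟩

theorem ultraproduct_coherent_holds {a : CoherentFormula L}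
    (h : ∀ᶠ i in (𝓤 : Filter ι), a.Holds (M i)) : a.Holds ((𝓤 : Filter ι).Product M) := by
  classical
  intro v hv
  obtain ⟨v, rfl⟩ := exists_ofFamily_val v
  have hw : ∀ i, ∃ w : ℕ → M i, (∀ x ∉ a.exVars, w x = v x i) ∧
      (a.Holds (M i) → HoldsB (fun x => v x i) a.premise → HoldsB w a.conclusion) := by
    intro i
    by_cases hi : a.Holds (M i) ∧ HoldsB (fun x => v x i) a.premise
    · obtain ⟨w, hw, hwc⟩ := hi.1 _ hi.2
      exact ⟨w, hw, fun _ _ => hwc⟩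
    · exact ⟨fun x => v x i, fun _ _ => rfl, fun h₁ h₂ => absurd ⟨h₁, h₂⟩ hi⟩
  choose w hw hwc using hw
  refine ⟨fun x => ofFamily 𝓤 fun i => w i x, fun x hx => ?_, ?_⟩
  · exact congrArg _ (funext fun i => hw i x hx)
  · refine (ultraproduct_holdsB_iff _ _).2 ?_
    filter_upwards [h, (ultraproduct_holdsB_iff _ _).1 hv] with i h₁ h₂ using hwc i h₁ h₂

theorem ultraproduct_rule_holds {I : ∀ i, ∀ k, S k → (Fin k → M i) → Prop} {r : Rule L S}
    (hprop : r.IsPropagation) (h : ∀ i, r.Holds (M i) (I i)) :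
    r.Holds ((𝓤 : Filter ι).Product M) (ultraInterp 𝓤 I) := by
  classical
  intro v ⟨hK, hG⟩
  obtain ⟨v, rfl⟩ := exists_ofFamily_val v
  have hrem : r.removed = 0 := hprop
  have hw : ∀ i, ∃ w : ℕ → M i, (∀ x ∈ fvU (r.kept + r.removed), w x = v x i) ∧
      (HoldsU (I i) (fun x => v x i) r.kept → HoldsB (fun x => v x i) r.guard →
        HoldsB w r.guard ∧ HoldsB w r.bodyB ∧ HoldsU (I i) w r.bodyU) := by
    intro i
    by_cases hi : HoldsU (I i) (fun x => v x i) r.kept ∧ HoldsB (fun x => v x i) r.guard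
    · obtain ⟨w, hw, hwc⟩ := (h i _ hi).1 (by simp [hrem, HoldsU])
      exact ⟨w, hw, fun _ _ => hwc⟩
    · exact ⟨fun x => v x i, fun _ _ => rfl, fun h₁ h₂ => absurd ⟨h₁, h₂⟩ hi⟩
  choose w hw hwc using hw
  have hbody : ∀ᶠ i in (𝓤 : Filter ι),
      HoldsB (w i) r.guard ∧ HoldsB (w i) r.bodyB ∧ HoldsU (I i) (w i) r.bodyU := by
    filter_upwards [(ultraproduct_holdsU_iff _ _).1 hK, (ultraproduct_holdsB_iff _ _).1 hG]
      with i h₁ h₂ using hwc i h₁ h₂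
  refine iff_of_true (by simp [hrem, HoldsU])
    ⟨fun x => ofFamily 𝓤 fun i => w i x, fun x hx => ?_, ?_, ?_, ?_⟩
  · exact congrArg _ (funext fun i => hw i x hx)
  · exact (ultraproduct_holdsB_iff _ _).2 (hbody.mono fun _ h => h.1)
  · exact (ultraproduct_holdsB_iff _ _).2 (hbody.mono fun _ h => h.2.1)
  · exact (ultraproduct_holdsU_iff _ _).2 (hbody.mono fun _ h => h.2.2)

end Ultraproduct

/-- Satisfiability within a CPR program is determined by the finite parts of the constraint
theory: axioms and propagation rules are preserved by ultraproducts. -/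
theorem satisfiableWithin_of_finite {CT : ConstraintTheory L} {P : Program L S} (hP : P.IsCPR)
    {E : Multiset (UserConstraint L S)} {C : Multiset (BuiltIn L)}
    (h : ∀ T : Finset CT, SatisfiableWithin (Subtype.val '' (T : Set CT)) P E C) :
    SatisfiableWithin CT P E C := by
  classical
  choose M hne hstr I hT hrule v hvE hvC using h
  let 𝓤 : Ultrafilter (Finset CT) := Ultrafilter.of Filter.atTop
  have h𝓤 : (𝓤 : Filter (Finset CT)) ≤ Filter.atTop := Ultrafilter.of_le _
  refine ⟨(𝓤 : Filter (Finset CT)).Product M, ⟨ofFamily 𝓤 fun T => (hne T).some⟩, inferInstance,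
    ultraInterp 𝓤 I, fun a ha => ultraproduct_coherent_holds ?_,
    fun r hr => ultraproduct_rule_holds (hP r hr) fun T => hrule T r hr,
    fun x => ofFamily 𝓤 fun T => v T x, (ultraproduct_holdsU_iff _ _).2 (.of_forall hvE),
    (ultraproduct_holdsB_iff _ _).2 (.of_forall hvC)⟩
  filter_upwards [h𝓤 (Filter.eventually_ge_atTop {⟨a, ha⟩})] with T hTa
  exact hT T a ⟨⟨a, ha⟩, hTa (Finset.mem_singleton_self _), rfl⟩

end CHR

theorem mainTheorem1 {L : FirstOrder.Language.{u, u}} {S : ℕ → Type u} (CT : CHR.ConstraintTheory L)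
    (P : CHR.Program L S) (hP : P.IsCPR) (n : ℕ) (hn : ∀ r ∈ P.rules, r.headSize < n)
    (E : Multiset (CHR.UserConstraint L S)) (C : Multiset (CHR.BuiltIn L)) (X : Finset ℕ) :
    (⟨n • E, C, X⟩ : CHR.State L S) ∈ CHR.coinductiveSemantics CT (P.scale n) ↔
      CHR.SatisfiableWithin CT P E C := by
  refine ⟨fun h => ?_, fun h => ?_⟩
  · refine CHR.satisfiableWithin_of_finite hP fun T => ?_
    exact CHR.satisfiableWithin_of_countable hP hn h (T.countable_toSet.image _) (by simp)
  · refine CHR.mem_coinductiveSemantics_of_satisfiable hP n ?_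
    obtain ⟨M, hne, hstr, I, hCT, hrule, v, hE, hC⟩ := h
    exact ⟨M, hne, hstr, I, hCT, hrule, v, hE.nsmul n, hC⟩
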